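/- Let $\omega^+=\omega\cup\{\omega\}$ be the ordinal $\omega+1$ with its usual order. A \emph{time warp} is a map $f\colon\omega^+\to\omega^+$ that preserves arbitrary suprema (equivalently, $f$ is monotone, $f(0)=0$ and $f(\omega)=\bigvee\{f(n)\mid n\in\omega\}$). Let $W$ be the set of all time warps, ordered pointwise. Then $W$ is a lattice with meet $\wedge$, join $\vee$, least element $\bot$ (the constant map $0$) and greatest element $\top$ (which maps $0$ to $0$ and every $p\neq 0$ to $\omega$). Let $\circ$ be composition, $\mathrm{id}$ the identity map, and let $\backslash,/$ be the residuals of composition, i.e. the binary operations on $W$ determined by \[ f\le h/g \iff f\circ g\le h \iff g\le f\backslash h \qquad (f,g,h\in W). \] The \emph{time warp algebra} is $\mathbf W=\langle W,\wedge,\vee,\circ,\backslash,/,\mathrm{id},\bot,\top\rangle$. Terms are built from variables $x_0,x_1,x_2,\dots$ with the binary operation symbols $\wedge,\vee,\circ,\backslash,/$ and the constant symbols $\mathrm{id},\bot,\top$; an equation is an ordered pair of terms $s\approx t$, and it is valid in $\mathbf W$ if $s$ and $t$ have the same value under every assignment of time warps to the variables. \textbf{Theorem.} The equational theory of the time warp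 algebra is decidable: there is an algorithm that, given terms $s$ and $t$, decides whether the equation $s\approx t$ is valid in $\mathbf W$. -/

import Mathlib

/-- Time warps: maps on `ω + 1` (here `ℕ∞`) that preserve arbitrary suprema.
The order that Mathlib puts on `sSupHom` is the pointwise one, and its `⊥` is the constant
map `0`. -/
abbrev TimeWarp : Type := sSupHom ℕ∞ ℕ∞

namespace TimeWarp

theorem mono (f : TimeWarp) : Monotone f := OrderHomClass.mono f

/-- The pointwise supremum of a set of time warps. -/
noncomputable instance : SupSet TimeWarp where
  sSup F :=
    { toFun := fun p => ⨆ f : F, f.1 p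
      map_sSup' := fun s => by
        simp only [map_sSup, sSup_image]
        rw [iSup_comm]
        exact iSup_congr fun a => iSup_comm }

theorem sSup_apply (F : Set TimeWarp) (p : ℕ∞) : (sSup F : TimeWarp) p = ⨆ f : F, f.1 p := rfl

/-- Pointwise binary joins and meets; they are the joins and meets of the pointwise order. -/
noncomputable instance : Lattice TimeWarp where
  sup f g :=
    { toFun := fun p => f p ⊔ g p
      map_sSup' := fun s => by
        simp only [map_sSup, sSup_image, iSup_sup_eq] }
  inf f g :=
    { toFun := fun p => f p ⊓ g p
      map_sSup' := fun s => by
        apply le_antisymm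
        · simp only [map_sSup, sSup_inf_sSup]
          refine iSup₂_le ?_
          rintro ⟨x, y⟩ ⟨⟨a, ha, rfl⟩, ⟨b, hb, rfl⟩⟩
          rcases le_total a b with h | h
          · exact le_trans (inf_le_inf_right _ (mono f h)) (le_sSup ⟨b, hb, rfl⟩)
          · exact le_trans (inf_le_inf_left _ (mono g h)) (le_sSup ⟨a, ha, rfl⟩)
        · refine sSup_le ?_
          rintro _ ⟨a, ha, rfl⟩
          exact inf_le_inf (mono f (le_sSup ha)) (mono g (le_sSup ha)) }
  le_sup_left f g := fun p => le_sup_left (a := f p) (b := g p)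
  le_sup_right f g := fun p => le_sup_right (a := f p) (b := g p)
  sup_le f g h hf hg := fun p => sup_le (hf p) (hg p)
  inf_le_left f g := fun p => inf_le_left (a := f p) (b := g p)
  inf_le_right f g := fun p => inf_le_right (a := f p) (b := g p)
  le_inf f g h hf hg := fun p => le_inf (hf p) (hg p)

/-- The greatest time warp maps `0` to `0` and every other point to `ω`. -/
noncomputable instance : OrderTop TimeWarp where
  top :=
    { toFun := fun p => if p = 0 then 0 else ⊤
      map_sSup' := fun s => by
        apply le_antisymm
        · by_cases h : sSup s = 0
          · simp [h]
          · have h' : ∃ a ∈ s, a ≠ 0 := by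
              by_contra! hc
              exact h (nonpos_iff_eq_zero.mp (sSup_le fun a ha => (hc a ha).le))
            obtain ⟨a, ha, ha0⟩ := h'
            exact le_trans le_top (le_sSup ⟨a, ha, by simp [ha0]⟩)
        · refine sSup_le ?_
          rintro _ ⟨a, ha, rfl⟩
          by_cases h : a = 0
          · simp [h]
          · have : sSup s ≠ 0 := fun h0 => h (nonpos_iff_eq_zero.mp (h0 ▸ le_sSup ha))
            simp [h, this] }
  le_top f := fun p => by
    change f p ≤ if p = 0 then 0 else ⊤
    split_ifs with h
    · subst h
      exact (map_bot f).le
    · exact le_top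

/-- The residual `f \ h`: the largest `g` with `f ∘ g ≤ h`. -/
noncomputable def ld (f h : TimeWarp) : TimeWarp := sSup {g | f.comp g ≤ h}

/-- The residual `h / g`: the largest `f` with `f ∘ g ≤ h`. -/
noncomputable def rd (h g : TimeWarp) : TimeWarp := sSup {f | f.comp g ≤ h}

theorem le_ld_iff (f g h : TimeWarp) : g ≤ ld f h ↔ f.comp g ≤ h := by
  constructor
  · intro H p
    refine le_trans (mono f (H p)) ?_
    rw [ld, sSup_apply, map_iSup]
    exact iSup_le fun k => k.2 p
  · intro H p
    exact le_iSup (fun k : {g : TimeWarp | f.comp g ≤ h} => k.1 p) ⟨g, H⟩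

theorem le_rd_iff (f g h : TimeWarp) : f ≤ rd h g ↔ f.comp g ≤ h := by
  constructor
  · intro H p
    refine le_trans (H (g p)) ?_
    rw [rd, sSup_apply]
    exact iSup_le fun k => k.2 p
  · intro H p
    exact le_iSup (fun k : {f : TimeWarp | f.comp g ≤ h} => k.1 p) ⟨f, H⟩

end TimeWarp

/-- Time warp terms over the variables `x₀, x₁, x₂, …`. -/
inductive WarpTerm : Type
  | var (n : ℕ)
  | id
  | bot
  | top
  | meet (s t : WarpTerm)
  | join (s t : WarpTerm)
  | comp (s t : WarpTerm)
  | ld (s t : WarpTerm)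
  | rd (s t : WarpTerm)

namespace WarpTerm

/-- The value of a term in the time warp algebra under a valuation of the variables;
`ld s t` stands for `s \ t` and `rd s t` for `s / t`. -/
noncomputable def eval (θ : ℕ → TimeWarp) : WarpTerm → TimeWarp
  | var n => θ n
  | id => sSupHom.id ℕ∞
  | bot => ⊥
  | top => ⊤
  | meet s t => eval θ s ⊓ eval θ t
  | join s t => eval θ s ⊔ eval θ t
  | comp s t => (eval θ s).comp (eval θ t)
  | ld s t => TimeWarp.ld (eval θ s) (eval θ t)
  | rd s t => TimeWarp.rd (eval θ s) (eval θ t)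

/-- A Gödel numbering of the terms (`Nat.pair` is a primitive recursive bijection
`ℕ × ℕ → ℕ`). -/
def code : WarpTerm → ℕ
  | id => 0
  | bot => 1
  | top => 2
  | var n => 6 * n + 3
  | meet s t => 6 * Nat.pair (code s) (code t) + 4
  | join s t => 6 * Nat.pair (code s) (code t) + 5
  | comp s t => 6 * Nat.pair (code s) (code t) + 6
  | ld s t => 6 * Nat.pair (code s) (code t) + 7
  | rd s t => 6 * Nat.pair (code s) (code t) + 8

/-- The term with a given Gödel number. -/
def ofCode : ℕ → WarpTerm
  | 0 => id
  | 1 => bot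
  | 2 => top
  | n + 3 =>
    have hm : n / 6 < n + 3 := by omega
    have _h1 : (n / 6).unpair.1 < n + 3 := lt_of_le_of_lt (n / 6).unpair_left_le hm
    have _h2 : (n / 6).unpair.2 < n + 3 := lt_of_le_of_lt (n / 6).unpair_right_le hm
    match n % 6 with
    | 0 => var (n / 6)
    | 1 => meet (ofCode (n / 6).unpair.1) (ofCode (n / 6).unpair.2)
    | 2 => join (ofCode (n / 6).unpair.1) (ofCode (n / 6).unpair.2)
    | 3 => comp (ofCode (n / 6).unpair.1) (ofCode (n / 6).unpair.2)
    | 4 => ld (ofCode (n / 6).unpair.1) (ofCode (n / 6).unpair.2)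
    | _ => rd (ofCode (n / 6).unpair.1) (ofCode (n / 6).unpair.2)

theorem ofCode_code (t : WarpTerm) : ofCode (code t) = t := by
  have e (a r : ℕ) (hr : r < 6) : (6 * a + r) / 6 = a ∧ (6 * a + r) % 6 = r := by omega
  induction t with
  | var n => simp [code, ofCode]
  | id => simp [code, ofCode]
  | bot => simp [code, ofCode]
  | top => simp [code, ofCode]
  | meet s t hs ht =>
    have := e (Nat.pair (code s) (code t)) 1 (by omega)
    rw [code, ofCode]; simp only [this, Nat.unpair_pair, hs, ht]
  | join s t hs ht =>
    have := e (Nat.pair (code s) (code t)) 2 (by omega)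
    rw [code, ofCode]; simp only [this, Nat.unpair_pair, hs, ht]
  | comp s t hs ht =>
    have := e (Nat.pair (code s) (code t)) 3 (by omega)
    rw [code, ofCode]; simp only [this, Nat.unpair_pair, hs, ht]
  | ld s t hs ht =>
    have := e (Nat.pair (code s) (code t)) 4 (by omega)
    rw [code, ofCode]; simp only [this, Nat.unpair_pair, hs, ht]
  | rd s t hs ht =>
    have := e (Nat.pair (code s) (code t)) 5 (by omega)
    rw [code, ofCode]; simp only [this, Nat.unpair_pair, hs, ht]

theorem code_ofCode (n : ℕ) : code (ofCode n) = n := by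
  induction n using Nat.strong_induction_on with
  | _ n ih =>
    match n with
    | 0 => simp [code, ofCode]
    | 1 => simp [code, ofCode]
    | 2 => simp [code, ofCode]
    | n + 3 =>
      have hm : n / 6 < n + 3 := by omega
      have h1 := ih _ (lt_of_le_of_lt (n / 6).unpair_left_le hm)
      have h2 := ih _ (lt_of_le_of_lt (n / 6).unpair_right_le hm)
      have h6 : n % 6 = 0 ∨ n % 6 = 1 ∨ n % 6 = 2 ∨ n % 6 = 3 ∨ n % 6 = 4 ∨ n % 6 = 5 := by omega
      rw [ofCode]
      rcases h6 with h | h | h | h | h | h <;>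
        simp only [h, code, h1, h2, Nat.pair_unpair] <;> omega

/-- Terms are encoded by their Gödel numbers; this is the encoding that Mathlib's notion of
computability uses for `WarpTerm`. -/
instance : Denumerable WarpTerm :=
  Denumerable.mk' ⟨code, ofCode, ofCode_code, code_ofCode⟩

end WarpTerm

/-- The equation `s ≈ t` (as the ordered pair `(s, t)`) is valid in the time warp algebra. -/
def TimeWarp.Models (e : WarpTerm × WarpTerm) : Prop :=
  ∀ θ : ℕ → TimeWarp, e.1.eval θ = e.2.eval θ

/-- The equational theory of the time warp algebra: the set of all valid equations. -/
def TimeWarp.equationalTheory : Set (WarpTerm × WarpTerm) :=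
  {e | TimeWarp.Models e}

/-!
An equation that fails, fails at some point of `ω + 1` under some assignment. Whether a term takes a
given value at a given point is decided by the values of its subterms at boundedly many other points
(successors, predecessors and least preimages of points met before), together with one bit for each
subterm: whether it reaches `ω` at a finite point or only in the limit. The bit is what the
residuals at `ω` depend on. Sampling the subterms on these points therefore yields a finite table
that obeys local rules. Conversely, a table that obeys the rules comes from an actual assignment:
step functions realize the rows of the variables, and the rules propagate to all terms by induction
on Gödel numbers. Since the size of the table is bounded in terms of the equation, validity amounts
to a bounded search, which is primitive recursive.
-/

namespace TimeWarp

theorem apply_zero (f : TimeWarp) : f 0 = 0 := map_bot f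

theorem ne_zero_of_lt_apply {f : TimeWarp} {x p : ℕ∞} (h : x < f p) : p ≠ 0 := by
  rintro rfl
  exact not_lt_zero (h.trans_eq f.apply_zero)

theorem apply_top (f : TimeWarp) : f ⊤ = ⨆ n : ℕ, f n := by
  rw [← map_iSup, ENat.iSup_natCast]

theorem exists_lt_apply {f : TimeWarp} {x : ℕ∞} (h : x < f ⊤) : ∃ n : ℕ, x < f n := by
  rwa [apply_top, lt_iSup_iff] at h

theorem exists_le_apply {f : TimeWarp} {x : ℕ∞} (hx : x ≠ ⊤) (h : x ≤ f ⊤) :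
    ∃ n : ℕ, n ≠ 0 ∧ x ≤ f n := by
  obtain rfl | hne := eq_or_ne x 0
  · exact ⟨1, one_ne_zero, zero_le⟩
  · obtain ⟨y, rfl⟩ : ∃ y, x = y + 1 := ⟨x - 1, (tsub_add_cancel_of_le
      (Order.one_le_iff_pos.2 (pos_iff_ne_zero.2 hne))).symm⟩
    have hy : y ≠ ⊤ := by rintro rfl; exact hx rfl
    obtain ⟨n, hn⟩ := exists_lt_apply ((ENat.add_one_le_iff hy).1 h)
    exact ⟨n, mod_cast ne_zero_of_lt_apply hn, Order.add_one_le_of_lt hn⟩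

/-- A time warp that takes the value `⊤` at a finite point. -/
def ReachesTop (f : TimeWarp) : Prop := ∃ n : ℕ, f n = ⊤

/-- A time warp that takes the value `⊤`, but only in the limit. -/
def ApproachesTop (f : TimeWarp) : Prop := f ⊤ = ⊤ ∧ ¬ f.ReachesTop

theorem ReachesTop.apply_top {f : TimeWarp} (h : f.ReachesTop) : f ⊤ = ⊤ := by
  obtain ⟨n, hn⟩ := h
  exact top_le_iff.1 (hn.symm.le.trans (f.mono le_top))

theorem ApproachesTop.apply_lt_top {f : TimeWarp} (hf : f.ApproachesTop) (n : ℕ) : f n < ⊤ :=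
  lt_top_iff_ne_top.2 fun h => hf.2 ⟨n, h⟩

theorem exists_nat_apply_eq {h : TimeWarp} {p : ℕ∞} (hp : p ≠ 0)
    (hlim : ¬ (p = ⊤ ∧ h.ApproachesTop)) : ∃ n : ℕ, n ≠ 0 ∧ n ≤ p ∧ h n = h p := by
  obtain rfl | hpt := eq_or_ne p ⊤
  · obtain ⟨n, hn, hle⟩ : ∃ n : ℕ, n ≠ 0 ∧ h ⊤ ≤ h n := by
      by_cases ht : h ⊤ = ⊤
      · obtain ⟨n, hn⟩ : h.ReachesTop := by_contra fun hr => hlim ⟨rfl, ht, hr⟩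
        exact ⟨n + 1, n.succ_ne_zero, le_top.trans (hn.ge.trans (h.mono (by simp)))⟩
      · exact exists_le_apply ht le_rfl
    exact ⟨n, hn, le_top, (h.mono le_top).antisymm hle⟩
  · lift p to ℕ using hpt
    exact ⟨p, mod_cast hp, le_rfl, rfl⟩

theorem exists_apply_lt_le_apply_add_one {g : TimeWarp} {p : ℕ∞} (hp : p ≠ 0) (hle : p ≤ g ⊤)
    (hlim : ¬ (p = ⊤ ∧ g.ApproachesTop)) : ∃ k : ℕ, g k < p ∧ p ≤ g (k + 1) := by
  classical
  have hex : ∃ n : ℕ, p ≤ g n := by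
    by_cases hpt : p = ⊤
    · subst hpt
      obtain ⟨n, hn⟩ : g.ReachesTop := by_contra fun hr => hlim ⟨rfl, top_le_iff.1 hle, hr⟩
      exact ⟨n, hn.ge⟩
    · exact (exists_le_apply hpt hle).imp fun _ => And.right
  obtain ⟨k, hk⟩ : ∃ k, Nat.find hex = k + 1 := Nat.exists_eq_succ_of_ne_zero fun h0 => by
    have := Nat.find_spec hex
    rw [h0, Nat.cast_zero, apply_zero] at this
    exact hp (nonpos_iff_eq_zero.1 this)
  refine ⟨k, not_le.1 (Nat.find_min hex (by omega)), ?_⟩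
  have := Nat.find_spec hex
  rwa [hk, Nat.cast_add_one] at this

theorem exists_nat_le_apply_imp {g : TimeWarp} {p : ℕ∞} (hp : p ≠ 0)
    (hlim : ¬ (p = ⊤ ∧ g.ApproachesTop)) :
    ∃ k : ℕ, k < p ∧ ∀ x, k < g x → p ≤ g x := by
  obtain hgt | hle := lt_or_ge (g ⊤) p
  · lift g ⊤ to ℕ using hgt.ne_top with k hk
    exact ⟨k, hgt, fun x hx => absurd (hx.trans_le (g.mono le_top)) (by simp [hk])⟩
  · obtain ⟨k, hlt, hle⟩ := exists_apply_lt_le_apply_add_one hp hle hlim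
    lift g k to ℕ using hlt.ne_top with m hm
    refine ⟨m, hlt, fun x hx => hle.trans (g.mono (Order.add_one_le_of_lt ?_))⟩
    exact g.mono.reflect_lt (hm ▸ hx)

/-- The time warp with value `r` above `x`, and `0` elsewhere. -/
noncomputable def step (x r : ℕ∞) : TimeWarp where
  toFun p := if x < p then r else 0
  map_sSup' s := by
    apply le_antisymm
    · split_ifs with h
      · obtain ⟨y, hy, hxy⟩ := lt_sSup_iff.1 h
        exact le_sSup ⟨y, hy, if_pos hxy⟩
      · exact zero_le
    · refine sSup_le ?_
      rintro _ ⟨y, hy, rfl⟩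
      dsimp only
      split_ifs with h h'
      · exact le_rfl
      · exact absurd (h.trans_le (le_sSup hy)) h'
      all_goals exact zero_le

theorem step_apply (x r p : ℕ∞) : step x r p = if x < p then r else 0 := rfl

theorem apply_ld_apply_le (f h : TimeWarp) (p : ℕ∞) : f (ld f h p) ≤ h p :=
  (le_ld_iff f (ld f h) h).1 le_rfl p

theorem rd_apply_apply_le (h g : TimeWarp) (p : ℕ∞) : rd h g (g p) ≤ h p :=
  (le_rd_iff (rd h g) g h).1 le_rfl p

theorem le_ld_apply {f h : TimeWarp} {n : ℕ} {r : ℕ∞} (hn : n ≠ 0) (hr : f r ≤ h n) :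
    r ≤ ld f h n := by
  obtain ⟨k, rfl⟩ := Nat.exists_eq_succ_of_ne_zero hn
  have hstep : step k r ≤ ld f h := (le_ld_iff f _ h).2 fun p => by
    change f (step k r p) ≤ h p
    rw [step_apply]
    split_ifs with hp
    · exact hr.trans (h.mono (Order.add_one_le_of_lt hp))
    · exact f.apply_zero.trans_le zero_le
  simpa only [step_apply, Nat.cast_lt, Nat.lt_succ_self, if_true] using hstep (k + 1 : ℕ)

theorem le_rd_apply {h g : TimeWarp} {k : ℕ} {p r : ℕ∞} (hp : k < p)
    (hr : ∀ x, k < g x → r ≤ h x) : r ≤ rd h g p := by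
  have hstep : step k r ≤ rd h g := (le_rd_iff _ g h).2 fun x => by
    change step k r (g x) ≤ h x
    rw [step_apply]
    split_ifs with hx
    · exact hr x hx
    · exact zero_le
  simpa [step_apply, hp] using hstep p

theorem le_ld_apply_iff {f h : TimeWarp} {p : ℕ∞} (hp : p ≠ 0)
    (hlim : ¬ (p = ⊤ ∧ h.ApproachesTop)) (r : ℕ∞) : r ≤ ld f h p ↔ f r ≤ h p := by
  refine ⟨fun hr => (f.mono hr).trans (apply_ld_apply_le f h p), fun hr => ?_⟩
  obtain ⟨n, hn, hnp, heq⟩ := exists_nat_apply_eq hp hlim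
  exact (le_ld_apply hn (hr.trans heq.ge)).trans ((ld f h).mono hnp)

theorem le_rd_apply_iff {h g : TimeWarp} {p : ℕ∞} (hp : p ≠ 0)
    (hlim : ¬ (p = ⊤ ∧ g.ApproachesTop)) (r : ℕ∞) :
    r ≤ rd h g p ↔ ∀ x, p ≤ g x → r ≤ h x := by
  refine ⟨fun hr x hx => hr.trans (((rd h g).mono hx).trans (rd_apply_apply_le h g x)),
    fun hr => ?_⟩
  obtain ⟨k, hk, hg⟩ := exists_nat_le_apply_imp hp hlim
  exact le_rd_apply hk fun x hx => hr x (hg x hx)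

theorem lt_ld_apply_top_iff {f h : TimeWarp} (hh : h.ApproachesTop) {x : ℕ∞} (hx : x ≠ ⊤) :
    x < ld f h ⊤ ↔ f (x + 1) < ⊤ := by
  constructor
  · intro hlt
    obtain ⟨n, hn⟩ := exists_lt_apply hlt
    exact (f.mono (Order.add_one_le_of_lt hn)).trans_lt
      ((apply_ld_apply_le f h n).trans_lt (hh.apply_lt_top n))
  · intro hlt
    obtain ⟨n, hn⟩ := exists_lt_apply (hlt.trans_eq hh.1.symm)
    have hle : x + 1 ≤ ld f h n := le_ld_apply (mod_cast ne_zero_of_lt_apply hn) hn.le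
    exact ((ENat.add_one_le_iff hx).1 hle).trans_le ((ld f h).mono le_top)

theorem ld_apply_eq_iff {f h : TimeWarp} {p : ℕ∞} (hp : p ≠ 0)
    (hlim : ¬ (p = ⊤ ∧ h.ApproachesTop)) (q : ℕ∞) :
    ld f h p = q ↔ f q ≤ h p ∧ (q ≠ ⊤ → h p < f (q + 1)) := by
  have key (r : ℕ∞) := le_ld_apply_iff (f := f) hp hlim r
  rw [eq_comm, le_antisymm_iff, key]
  refine and_congr_right fun _ => ?_
  by_cases hq : q = ⊤
  · simp [hq]
  · rw [← not_lt, ← ENat.add_one_le_iff hq, key, not_le]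
    exact ⟨fun h _ => h, fun h => h hq⟩

theorem ld_apply_top_eq_top_iff {f h : TimeWarp} (hh : h.ApproachesTop) :
    ld f h ⊤ = ⊤ ↔ ¬ f.ReachesTop := by
  constructor
  · rintro hld ⟨n, hn⟩
    have hlt : f (n + 1) < ⊤ :=
      (lt_ld_apply_top_iff hh (ENat.natCast_ne_top n)).1 ((ENat.natCast_lt_top n).trans_eq hld.symm)
    exact ((f.mono le_self_add).trans_lt hlt).ne hn
  · intro hf
    refine ENat.eq_top_iff_forall_gt.2 fun n => ?_
    exact (lt_ld_apply_top_iff hh (ENat.natCast_ne_top n)).2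
      (lt_top_iff_ne_top.2 fun hn => hf ⟨n + 1, mod_cast hn⟩)

theorem ld_apply_top_eq_iff {f h : TimeWarp} (hh : h.ApproachesTop) {q : ℕ∞} (hq : q ≠ ⊤) :
    ld f h ⊤ = q ↔ f q < ⊤ ∧ f (q + 1) = ⊤ := by
  rw [le_antisymm_iff, and_comm, ← not_lt (a := q), lt_ld_apply_top_iff hh hq, lt_top_iff_ne_top,
    not_not]
  refine and_congr_left fun _ => ?_
  obtain rfl | hne := eq_or_ne q 0
  · simp [apply_zero]
  · obtain ⟨x, rfl⟩ : ∃ x, q = x + 1 := ⟨q - 1, (tsub_add_cancel_of_le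
      (Order.one_le_iff_pos.2 (pos_iff_ne_zero.2 hne))).symm⟩
    have hx : x ≠ ⊤ := by rintro rfl; exact hq rfl
    rw [ENat.add_one_le_iff hx, lt_ld_apply_top_iff hh hx]

theorem rd_apply_eq_top {h g : TimeWarp} {p : ℕ∞} (hp : g ⊤ < p) : rd h g p = ⊤ := by
  refine top_le_iff.1 ((le_rd_apply_iff (pos_of_gt hp).ne' ?_ _).2 fun x hx => ?_)
  · rintro ⟨rfl, htop, -⟩
    exact hp.ne htop
  · exact absurd (hx.trans (g.mono le_top)) hp.not_ge

theorem le_rd_apply_of_apply_lt {h g : TimeWarp} {x p r : ℕ∞} (hp : g x < p)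
    (hr : ∀ y, x < y → r ≤ h y) : r ≤ rd h g p := by
  lift g x to ℕ using hp.ne_top with k hk
  exact le_rd_apply hp fun y hy => hr y (g.mono.reflect_lt (hk ▸ hy))

theorem rd_apply_eq {h g : TimeWarp} {x p : ℕ∞} (hlt : g x < p) (hle : p ≤ g (x + 1)) :
    rd h g p = h (x + 1) :=
  (((rd h g).mono hle).trans (rd_apply_apply_le h g _)).antisymm
    (le_rd_apply_of_apply_lt hlt fun _ hy => h.mono (Order.add_one_le_of_lt hy))

theorem rd_apply_top {h g : TimeWarp} (hg : g.ApproachesTop) : rd h g ⊤ = h ⊤ := by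
  refine le_antisymm ?_ ?_
  · simpa only [hg.1] using rd_apply_apply_le h g ⊤
  · rw [h.apply_top]
    exact iSup_le fun n => le_rd_apply_of_apply_lt (hg.apply_lt_top n) fun y hy => h.mono hy.le

theorem not_reachesTop_bot : ¬ ReachesTop ⊥ := fun ⟨_, hn⟩ => ENat.zero_ne_top hn

theorem not_reachesTop_id : ¬ ReachesTop (sSupHom.id ℕ∞) := fun ⟨n, hn⟩ =>
  ENat.natCast_ne_top n hn

theorem top_apply {p : ℕ∞} (hp : p ≠ 0) : (⊤ : TimeWarp) p = ⊤ := if_neg hp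

theorem reachesTop_top : ReachesTop ⊤ := ⟨1, top_apply one_ne_zero⟩

theorem reachesTop_inf_iff {f g : TimeWarp} :
    (f ⊓ g).ReachesTop ↔ f.ReachesTop ∧ g.ReachesTop := by
  constructor
  · rintro ⟨n, hn⟩
    exact ⟨⟨n, (inf_eq_top_iff.1 hn).1⟩, ⟨n, (inf_eq_top_iff.1 hn).2⟩⟩
  · rintro ⟨⟨m, hm⟩, ⟨n, hn⟩⟩
    have hle {k : ℕ} (hk : k ≤ m + n) (u : TimeWarp) (hu : u k = ⊤) : u (m + n : ℕ) = ⊤ :=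
      top_le_iff.1 (hu.ge.trans (u.mono (mod_cast hk)))
    exact ⟨m + n, inf_eq_top_iff.2 ⟨hle (by omega) f hm, hle (by omega) g hn⟩⟩

theorem reachesTop_sup_iff {f g : TimeWarp} :
    (f ⊔ g).ReachesTop ↔ f.ReachesTop ∨ g.ReachesTop := by
  simp only [ReachesTop, ← exists_or]
  exact exists_congr fun n => max_eq_top

theorem reachesTop_comp_iff {f g : TimeWarp} :
    ReachesTop (f.comp g) ↔ f (g ⊤) = ⊤ ∧ (f.ReachesTop ∨ g.ReachesTop) := by
  constructor
  · intro h
    refine ⟨h.apply_top, ?_⟩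
    obtain ⟨n, hn⟩ := h
    by_cases hg : g n = ⊤
    · exact .inr ⟨n, hg⟩
    · lift g n to ℕ using hg with m hm
      exact .inl ⟨m, by rw [hm]; exact hn⟩
  · rintro ⟨htop, ⟨m, hm⟩ | hg⟩
    · have hmin : f (g ⊤ ⊓ m) = ⊤ := by rw [f.mono.map_min, htop, hm, inf_top_eq]
      have hne : g ⊤ ⊓ m ≠ ⊤ := (inf_le_right.trans_lt (ENat.natCast_lt_top m)).ne
      obtain ⟨n, -, hn⟩ := exists_le_apply hne inf_le_left
      exact ⟨n, top_le_iff.1 (hmin.ge.trans (f.mono hn))⟩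
    · obtain ⟨n, hn⟩ := id hg
      exact ⟨n, (congrArg f (hn.trans hg.apply_top.symm)).trans htop⟩

theorem reachesTop_ld_iff {f h : TimeWarp} :
    (ld f h).ReachesTop ↔ f ⊤ ≤ h ⊤ ∧ (f ⊤ = ⊤ → h.ReachesTop) := by
  constructor
  · rintro ⟨n, hn⟩
    have hle : f ⊤ ≤ h n := hn ▸ apply_ld_apply_le f h n
    exact ⟨hle.trans (h.mono le_top), fun hf => ⟨n, top_le_iff.1 (hf.ge.trans hle)⟩⟩
  · rintro ⟨hle, hreach⟩
    obtain ⟨n, hn, hfn⟩ : ∃ n : ℕ, n ≠ 0 ∧ f ⊤ ≤ h n := by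
      by_cases hf : f ⊤ = ⊤
      · obtain ⟨n, hn⟩ := hreach hf
        have hpos : 0 < h n := hn ▸ ENat.top_pos
        exact ⟨n, mod_cast ne_zero_of_lt_apply hpos, hn.ge.trans' le_top⟩
      · exact exists_le_apply hf hle
    exact ⟨n, top_le_iff.1 (le_ld_apply hn hfn)⟩

theorem reachesTop_rd_iff {h g : TimeWarp} :
    (rd h g).ReachesTop ↔ rd h g ⊤ = ⊤ ∧ (g.ApproachesTop → h.ReachesTop) := by
  constructor
  · intro hr
    refine ⟨hr.apply_top, fun hg => ?_⟩
    obtain ⟨n, hn⟩ := hr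
    obtain ⟨m, -, hm⟩ := exists_le_apply (ENat.natCast_ne_top n) (le_top.trans_eq hg.1.symm)
    exact ⟨m, top_le_iff.1 (hn.ge.trans (((rd h g).mono hm).trans (rd_apply_apply_le h g m)))⟩
  · rintro ⟨htop, hreach⟩
    by_cases hg : g.ApproachesTop
    · obtain ⟨m, hm⟩ := hreach hg
      lift g m to ℕ using (hg.apply_lt_top m).ne with k hk
      refine ⟨k + 1, top_le_iff.1 (le_rd_apply_of_apply_lt (x := m) ?_ fun y hy => ?_)⟩
      · rw [← hk]; exact mod_cast k.lt_succ_self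
      · exact hm.ge.trans (h.mono hy.le)
    · obtain ⟨k, -, hkg⟩ := exists_nat_le_apply_imp ENat.top_ne_zero fun hl => hg hl.2
      have hrd := (le_rd_apply_iff ENat.top_ne_zero (fun hl => hg hl.2) _).1 htop.ge
      refine ⟨k + 1, top_le_iff.1 (le_rd_apply (k := k) ?_ fun x hx => hrd x (hkg x hx))⟩
      exact mod_cast k.lt_succ_self

/-- The row `U` takes the value `T` strictly before `T`. A row tabulates a time warp on the points
`0, …, T` of a scale, whose last point stands for `ω`; entries above `T` are undefined. -/
def Reaches (T : ℕ) (U : ℕ → ℕ) : Prop := ∃ m < T, U m = T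

/-- The row `U` takes the value `T`, but only at `T`: the counterpart of `ApproachesTop`. -/
def Approaches (T : ℕ) (U : ℕ → ℕ) : Prop := U T = T ∧ ¬ Reaches T U

/-- An embedding of `{0, …, T}` into `ω + 1` that preserves both endpoints; the values of `e` off
`{0, …, T}` are irrelevant. -/
structure IsScale (T : ℕ) (e : ℕ → ℕ∞) : Prop where
  map_zero : e 0 = 0
  map_top : e T = ⊤
  strictMonoOn : StrictMonoOn e (Set.Iic T)

namespace IsScale

variable {T : ℕ} {e : ℕ → ℕ∞} {p q : ℕ} (he : IsScale T e)
include he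

theorem pos : 0 < T := by
  by_contra hT
  exact ENat.zero_ne_top (he.map_zero.symm.trans (by rw [← he.map_top, Nat.eq_zero_of_not_pos hT]))

theorem le_iff (hp : p ≤ T) (hq : q ≤ T) : e p ≤ e q ↔ p ≤ q := he.strictMonoOn.le_iff_le hp hq

theorem lt_iff (hp : p ≤ T) (hq : q ≤ T) : e p < e q ↔ p < q := he.strictMonoOn.lt_iff_lt hp hq

theorem eq_iff (hp : p ≤ T) (hq : q ≤ T) : e p = e q ↔ p = q := he.strictMonoOn.injOn.eq_iff hp hq

theorem eq_top_iff (hp : p ≤ T) : e p = ⊤ ↔ p = T := by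
  rw [← he.map_top, he.eq_iff hp le_rfl]

theorem eq_zero_iff (hp : p ≤ T) : e p = 0 ↔ p = 0 := by
  rw [← he.map_zero, he.eq_iff hp T.zero_le]

theorem lt_top (hp : p < T) : e p < ⊤ := by
  rw [← he.map_top]
  exact (he.lt_iff hp.le le_rfl).2 hp

theorem monotoneOn : MonotoneOn e (Set.Iic T) := he.strictMonoOn.monotoneOn

theorem top_apply_eq_iff (hp : p ≤ T) (hq : q ≤ T) :
    (⊤ : TimeWarp) (e p) = e q ↔ (p = 0 ∧ q = 0) ∨ (p ≠ 0 ∧ q = T) := by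
  by_cases hp0 : p = 0
  · simp [hp0, he.map_zero, apply_zero, eq_comm (a := (0 : ℕ∞)), he.eq_zero_iff hq]
  · rw [top_apply ((he.eq_zero_iff hp).not.2 hp0), eq_comm, he.eq_top_iff hq]
    simp [hp0]

theorem eq_add_one {m : ℕ} (hp : p < T) (hm : m ≤ T) (h : e m = e p + 1) : m = p + 1 := by
  have hlt : e p < e m := h ▸ (ENat.lt_add_one_iff (he.lt_top hp).ne).2 le_rfl
  have hle : e m ≤ e (p + 1) := h ▸ Order.add_one_le_of_lt ((he.lt_iff hp.le hp).2 p.lt_succ_self)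
  exact ((he.le_iff hm hp).1 hle).antisymm ((he.lt_iff hp.le hm).1 hlt)

end IsScale

/-- The scale with points `0, 1, …, T - 1` and `ω`. -/
noncomputable def point (T p : ℕ) : ℕ∞ := if p < T then p else ⊤

theorem point_of_lt {T p : ℕ} (hp : p < T) : point T p = p := if_pos hp

theorem point_self (T : ℕ) : point T T = ⊤ := if_neg (lt_irrefl T)

theorem point_mono (T : ℕ) : Monotone (point T) := fun p q hpq => by
  unfold point
  split_ifs with hp hq hq
  · exact mod_cast hpq
  · exact le_top
  · exact absurd (hpq.trans_lt hq) hp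
  · exact le_rfl

theorem isScale_point {T : ℕ} (hT : 0 < T) : IsScale T (point T) where
  map_zero := point_of_lt hT
  map_top := point_self T
  strictMonoOn p _ q (hq : q ≤ T) hpq := by
    rw [point_of_lt (hpq.trans_le hq)]
    unfold point
    split_ifs
    · exact mod_cast hpq
    · exact ENat.natCast_lt_top p

/-- Along the scale `e`, the row `U` records the time warp `f`: its defined entries, among them the
last one, are values of `f`, and it knows whether `f` reaches `ω` at a finite point. -/
structure Tabulates (e : ℕ → ℕ∞) (T : ℕ) (U : ℕ → ℕ) (f : TimeWarp) : Prop where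
  last_le : U T ≤ T
  apply_eq : ∀ {p : ℕ}, p ≤ T → U p ≤ T → f (e p) = e (U p)
  reachesTop_iff : f.ReachesTop ↔ Reaches T U

namespace Tabulates

variable {T : ℕ} {e : ℕ → ℕ∞} {A B : ℕ → ℕ} {f g h : TimeWarp} {p q : ℕ}

theorem apply_top (he : IsScale T e) (hA : Tabulates e T A f) : f ⊤ = e (A T) := by
  rw [← he.map_top, hA.apply_eq le_rfl hA.last_le]

theorem apply_top_eq_top_iff (he : IsScale T e) (hA : Tabulates e T A f) :
    f ⊤ = ⊤ ↔ A T = T := by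
  rw [hA.apply_top he, he.eq_top_iff hA.last_le]

theorem approachesTop_iff (he : IsScale T e) (hA : Tabulates e T A f) :
    f.ApproachesTop ↔ Approaches T A :=
  and_congr (hA.apply_top_eq_top_iff he) hA.reachesTop_iff.not

theorem inf_apply (he : IsScale T e) (hA : Tabulates e T A f) (hB : Tabulates e T B g)
    (hp : p ≤ T) (hAp : A p ≤ T) (hBp : B p ≤ T) : (f ⊓ g) (e p) = e (min (A p) (B p)) :=
  (congrArg₂ _ (hA.apply_eq hp hAp) (hB.apply_eq hp hBp)).trans
    (he.monotoneOn.map_min hAp hBp).symm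

theorem sup_apply (he : IsScale T e) (hA : Tabulates e T A f) (hB : Tabulates e T B g)
    (hp : p ≤ T) (hAp : A p ≤ T) (hBp : B p ≤ T) : (f ⊔ g) (e p) = e (max (A p) (B p)) :=
  (congrArg₂ _ (hA.apply_eq hp hAp) (hB.apply_eq hp hBp)).trans
    (he.monotoneOn.map_max hAp hBp).symm

theorem comp_apply (hA : Tabulates e T A f) (hB : Tabulates e T B g)
    (hp : p ≤ T) (hBp : B p ≤ T) (hAB : A (B p) ≤ T) : f.comp g (e p) = e (A (B p)) :=
  (congrArg f (hB.apply_eq hp hBp)).trans (hA.apply_eq hBp hAB)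

end Tabulates

/-- What the rows `A` of `f` and `B` of `h` say about `ld f h` having value `q` at `p ≠ 0`. -/
def LdSpec (T : ℕ) (A B : ℕ → ℕ) (p q : ℕ) : Prop :=
  (p = T ∧ Approaches T B → ¬ Reaches T A ∧ q = T ∨ q < T ∧ A q < T ∧ A (q + 1) = T) ∧
    (¬ (p = T ∧ Approaches T B) → A q ≤ B p ∧ (q < T → B p < A (q + 1)))

theorem Tabulates.ld_apply_eq_iff {T : ℕ} {e : ℕ → ℕ∞} {A B : ℕ → ℕ} {f h : TimeWarp} {p q : ℕ}
    (he : IsScale T e) (hA : Tabulates e T A f) (hB : Tabulates e T B h)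
    (hp : p ≤ T) (hp0 : p ≠ 0) (hq : q ≤ T) (hBp : B p ≤ T) (hAq : A q ≤ T)
    (hsucc : q < T → A (q + 1) ≤ T ∧ e (q + 1) = e q + 1) :
    ld f h (e p) = e q ↔ LdSpec T A B p q := by
  have hqT : e q ≠ ⊤ ↔ q < T := (he.eq_top_iff hq).not.trans ⟨hq.lt_of_ne, ne_of_lt⟩
  have hsucc' (hlt : q < T) : f (e q + 1) = e (A (q + 1)) :=
    (hsucc hlt).2 ▸ hA.apply_eq hlt (hsucc hlt).1
  by_cases hlim : p = T ∧ Approaches T B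
  · have hh : h.ApproachesTop := (hB.approachesTop_iff he).2 hlim.2
    simp only [LdSpec, hlim, and_self, forall_const, not_true_eq_false, IsEmpty.forall_iff,
      and_true, he.map_top]
    obtain rfl | hlt := hq.eq_or_lt
    · simp [he.map_top, ld_apply_top_eq_top_iff hh, hA.reachesTop_iff]
    · rw [ld_apply_top_eq_iff hh (hqT.2 hlt), hsucc' hlt, hA.apply_eq hq hAq,
        he.eq_top_iff (hsucc hlt).1, ← he.map_top, he.lt_iff hAq le_rfl]
      simp [hlt, hlt.ne]
  · have hlim' : ¬ (e p = ⊤ ∧ h.ApproachesTop) := by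
      rwa [he.eq_top_iff hp, hB.approachesTop_iff he]
    simp only [LdSpec, hlim, false_imp_iff, true_and, not_false_eq_true, forall_const]
    rw [TimeWarp.ld_apply_eq_iff ((he.eq_zero_iff hp).not.2 hp0) hlim', hA.apply_eq hq hAq,
      hB.apply_eq hp hBp, he.le_iff hAq hBp, hqT]
    refine and_congr_right fun _ => forall_congr' fun hlt => ?_
    rw [hsucc' hlt, he.lt_iff hBp (hsucc hlt).1]

end TimeWarp

namespace WarpTerm

theorem code_lt_of_code_eq {s t u : WarpTerm} {r : ℕ}
    (hu : u.code = 6 * Nat.pair s.code t.code + (r + 1)) : s.code < u.code ∧ t.code < u.code := by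
  have hs := Nat.left_le_pair s.code t.code
  have ht := Nat.right_le_pair s.code t.code
  omega

end WarpTerm

namespace TimeWarp

/-- The condition for `q` to be the value at `p` in the row `U` of a variable. The last clause is
continuity at `ω`: a finite supremum is attained. -/
def VarRule (T : ℕ) (U : ℕ → ℕ) (p q : ℕ) : Prop :=
  (p = 0 → q = 0) ∧ (∀ m < p, U m ≤ T → U m ≤ q) ∧ (p = T → q = T ∨ ∃ m < T, U m = q)

/-- The condition for `q` to be the value at `p` in the row of `ld f h`, given the rows `A` of `f`
and `B` of `h`. On the scale `point T` the successor of a point `q` is the next point only if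
`q + 1 < T`. -/
def LdRule (T : ℕ) (A B : ℕ → ℕ) (p q : ℕ) : Prop :=
  (p = 0 ∧ q = 0) ∨
    (p ≠ 0 ∧ B p ≤ T ∧ A q ≤ T ∧ (q < T → q + 1 < T ∧ A (q + 1) ≤ T) ∧ LdSpec T A B p q)

/-- The condition for `q` to be the value at `p` in the row of `rd h g`, given the rows `A` of `h`
and `B` of `g`. -/
def RdRule (T : ℕ) (A B : ℕ → ℕ) (p q : ℕ) : Prop :=
  (p = 0 ∧ q = 0) ∨ (B T < p ∧ q = T) ∨ (p = T ∧ Approaches T B ∧ q = A T) ∨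
    ∃ k < T, k + 1 < T ∧ B k < p ∧ p ≤ B (k + 1) ∧ B (k + 1) ≤ T ∧ q = A (k + 1)

/-- The condition on a table `V` of rows for `q` to be the value at `p` in the row of a term. -/
def ValueRule (T : ℕ) (V : WarpTerm → ℕ → ℕ) (p q : ℕ) : WarpTerm → Prop
  | .var n => VarRule T (V (.var n)) p q
  | .id => q = p
  | .bot => q = 0
  | .top => (p = 0 ∧ q = 0) ∨ (p ≠ 0 ∧ q = T)
  | .meet s t => V s p ≤ T ∧ V t p ≤ T ∧ q = min (V s p) (V t p)
  | .join s t => V s p ≤ T ∧ V t p ≤ T ∧ q = max (V s p) (V t p)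
  | .comp s t => V t p ≤ T ∧ q = V s (V t p)
  | .ld s t => LdRule T (V s) (V t) p q
  | .rd s t => RdRule T (V s) (V t) p q

/-- The condition on a table `V` of rows for the value of a term to reach `ω` at a finite point;
nothing is demanded of a variable. -/
def ReachRule (T : ℕ) (V : WarpTerm → ℕ → ℕ) : WarpTerm → Prop
  | .var n => Reaches T (V (.var n))
  | .id => False
  | .bot => False
  | .top => True
  | .meet s t => Reaches T (V s) ∧ Reaches T (V t)
  | .join s t => Reaches T (V s) ∨ Reaches T (V t)
  | .comp s t => V (.comp s t) T = T ∧ (Reaches T (V s) ∨ Reaches T (V t))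
  | .ld s t => V s T ≤ V t T ∧ (V s T = T → Reaches T (V t))
  | .rd s t => V (.rd s t) T = T ∧ (Approaches T (V t) → Reaches T (V s))

/-- The row of `t` in the table `V` has a last entry and obeys the rules. -/
def RowRule (T : ℕ) (V : WarpTerm → ℕ → ℕ) (t : WarpTerm) : Prop :=
  V t T ≤ T ∧ (∀ p ≤ T, V t p ≤ T → ValueRule T V p (V t p) t) ∧
    (Reaches T (V t) ↔ ReachRule T V t)

/-- A table of rows for the terms with Gödel number at most `N`, over the points `0, …, T`, that
obeys the rules. -/
def IsCertificate (N T : ℕ) (V : WarpTerm → ℕ → ℕ) : Prop :=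
  0 < T ∧ ∀ t : WarpTerm, t.code ≤ N → RowRule T V t

/-- The least time warp whose value above `k` is at least `r k`, for every natural number `k`. -/
noncomputable def ofSteps (r : ℕ → ℕ∞) : TimeWarp := sSup (Set.range fun k : ℕ => step k (r k))

theorem ofSteps_apply_le_iff {r : ℕ → ℕ∞} {p y : ℕ∞} :
    ofSteps r p ≤ y ↔ ∀ k : ℕ, k < p → r k ≤ y := by
  rw [ofSteps, sSup_apply, iSup_le_iff, Set.forall_subtype_range_iff]
  refine forall_congr' fun k => ?_
  rw [step_apply]
  split_ifs with hk <;> simp [hk]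

/-- A time warp that realizes the row `U` of a variable on the scale `point T`. Beyond the scale it
grows like the identity if it has to approach `ω`, and is constant otherwise. -/
noncomputable def realize (T : ℕ) (U : ℕ → ℕ) : TimeWarp :=
  open Classical in
  ofSteps fun k =>
    if k + 1 < T then if U (k + 1) ≤ T then point T (U (k + 1)) else 0
    else if Approaches T U then (k + 1 : ℕ) else 0

section realize

variable {T : ℕ} {U : ℕ → ℕ}

theorem realize_apply_le_iff {p y : ℕ∞} :
    realize T U p ≤ y ↔
      (∀ k : ℕ, k < p → k + 1 < T → U (k + 1) ≤ T → point T (U (k + 1)) ≤ y) ∧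
        (Approaches T U → ∀ k : ℕ, k < p → T ≤ k + 1 → ((k + 1 : ℕ) : ℕ∞) ≤ y) := by
  rw [realize, ofSteps_apply_le_iff]
  constructor
  · intro hle
    refine ⟨fun k hk hkT hU => ?_, fun happ k hk hkT => ?_⟩
    · simpa only [hkT, hU, if_true] using hle k hk
    · simpa only [hkT.not_gt, happ, if_true, if_false] using hle k hk
  · rintro ⟨hrow, htail⟩ k hk
    split_ifs with hkT hU happ
    · exact hrow k hk hkT hU
    · exact zero_le
    · exact htail happ k hk (not_lt.1 hkT)
    · exact zero_le

theorem realize_apply_of_lt (hU : ∀ p ≤ T, U p ≤ T → VarRule T U p (U p)) {p : ℕ} (hp : p < T)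
    (hUp : U p ≤ T) : realize T U p = point T (U p) := by
  refine le_antisymm (realize_apply_le_iff.2 ⟨fun k hk _ hUk => ?_, fun _ k hk hkT => ?_⟩) ?_
  · obtain hlt | heq := (Nat.succ_le_of_lt (Nat.cast_lt.1 hk)).lt_or_eq
    · exact point_mono T ((hU p hp.le hUp).2.1 _ hlt hUk)
    · exact (congrArg (fun m => point T (U m)) heq).le
  · exact absurd (Nat.cast_lt.1 hk) (by omega)
  · cases p with
    | zero =>
      rw [(hU 0 hp.le hUp).1 rfl, point_of_lt hp]
      exact zero_le
    | succ k => exact (realize_apply_le_iff.1 le_rfl).1 k (mod_cast k.lt_succ_self) hp hUp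

theorem realize_apply_top (hU : ∀ p ≤ T, U p ≤ T → VarRule T U p (U p))
    (hlast : U T ≤ T) : realize T U ⊤ = point T (U T) := by
  refine le_antisymm (realize_apply_le_iff.2 ⟨fun k _ hkT hUk => ?_, fun happ k _ _ => ?_⟩) ?_
  · exact point_mono T ((hU T le_rfl hlast).2.1 _ hkT hUk)
  · rw [happ.1, point_self]
    exact le_top
  · by_cases happ : Approaches T U
    · have htail := (realize_apply_le_iff.1 (le_refl (realize T U ⊤))).2 happ
      refine le_top.trans_eq (ENat.eq_top_iff_forall_ge.2 fun n => ?_).symm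
      exact (Nat.cast_le.2 (by omega)).trans (htail (n + T) (ENat.natCast_lt_top _) (by omega))
    · obtain ⟨m, hm, hUm⟩ : ∃ m < T, U m = U T := by
        obtain htop | hwit := (hU T le_rfl hlast).2.2 rfl
        · rw [htop]
          exact not_not.1 fun hr => happ ⟨htop, hr⟩
        · exact hwit
      rw [← hUm, ← realize_apply_of_lt hU hm (hUm ▸ hlast)]
      exact (realize T U).mono le_top

theorem reachesTop_realize_iff (hU : ∀ p ≤ T, U p ≤ T → VarRule T U p (U p)) :
    (realize T U).ReachesTop ↔ Reaches T U := by
  constructor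
  · rintro ⟨n, hn⟩
    by_contra hr
    refine (ENat.natCast_lt_top (T + n)).not_ge (hn.ge.trans (realize_apply_le_iff.2
      ⟨fun k _ hkT hUk => ?_, fun _ k hk _ => Nat.cast_le.2 ?_⟩))
    · have hlt : U (k + 1) < T := hUk.lt_of_ne fun heq => hr ⟨k + 1, hkT, heq⟩
      rw [point_of_lt hlt]
      exact Nat.cast_le.2 (by omega)
    · have := Nat.cast_lt.1 hk
      omega
  · rintro ⟨m, hm, hUm⟩
    exact ⟨m, by rw [realize_apply_of_lt hU hm hUm.le, hUm, point_self]⟩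

theorem tabulates_realize (hU : ∀ p ≤ T, U p ≤ T → VarRule T U p (U p))
    (hlast : U T ≤ T) : Tabulates (point T) T U (realize T U) where
  last_le := hlast
  apply_eq {p} hp hUp := by
    obtain rfl | hlt := hp.eq_or_lt
    · rw [point_self, realize_apply_top hU hlast]
    · rw [point_of_lt hlt, realize_apply_of_lt hU hlt hUp]
  reachesTop_iff := reachesTop_realize_iff hU

end realize

section soundness

variable {T : ℕ} {A B : ℕ → ℕ} {f g h : TimeWarp} {p q : ℕ}

theorem ld_apply_of_ldRule (hA : Tabulates (point T) T A f) (hB : Tabulates (point T) T B h)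
    (hT : 0 < T) (hp : p ≤ T) (hq : q ≤ T) (hrule : LdRule T A B p q) :
    ld f h (point T p) = point T q := by
  obtain ⟨rfl, rfl⟩ | ⟨hp0, hBp, hAq, hsucc, hspec⟩ := hrule
  · rw [(isScale_point hT).map_zero, apply_zero]
  · refine (hA.ld_apply_eq_iff (isScale_point hT) hB hp hp0 hq hBp hAq fun hlt => ?_).2 hspec
    rw [point_of_lt hlt, point_of_lt (hsucc hlt).1, Nat.cast_add_one]
    exact ⟨(hsucc hlt).2, rfl⟩

theorem rd_apply_of_rdRule (hA : Tabulates (point T) T A h) (hB : Tabulates (point T) T B g)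
    (hT : 0 < T) (hp : p ≤ T) (hq : q ≤ T) (hrule : RdRule T A B p q) :
    rd h g (point T p) = point T q := by
  have he := isScale_point hT
  obtain ⟨rfl, rfl⟩ | ⟨hlt, rfl⟩ | ⟨rfl, happ, rfl⟩ | ⟨k, hk, hk', hlt, hle, hBk, rfl⟩ := hrule
  · rw [he.map_zero, apply_zero]
  · rw [point_self]
    exact rd_apply_eq_top (hB.apply_top he ▸ (he.lt_iff hB.last_le hp).2 hlt)
  · rw [point_self, rd_apply_top ((hB.approachesTop_iff he).2 happ), hA.apply_top he]
  · have hsucc : point T (k + 1) = point T k + 1 := by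
      rw [point_of_lt hk, point_of_lt hk', Nat.cast_add_one]
    rw [← hA.apply_eq hk'.le hq, hsucc]
    refine rd_apply_eq ?_ ?_
    · rw [hB.apply_eq hk.le (hlt.le.trans hp)]
      exact (he.lt_iff (hlt.le.trans hp) hp).2 hlt
    · rw [← hsucc, hB.apply_eq hk'.le hBk]
      exact (he.le_iff hp hBk).2 hle

variable {V : WarpTerm → ℕ → ℕ} {θ : ℕ → TimeWarp} {t : WarpTerm}

theorem reachesTop_eval_iff {e : ℕ → ℕ∞} (he : IsScale T e) (hvar : ∀ n, t ≠ .var n)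
    (hsub : ∀ s : WarpTerm, s.code < t.code → Tabulates e T (V s) (s.eval θ))
    (htop : t.eval θ ⊤ = ⊤ ↔ V t T = T) :
    (t.eval θ).ReachesTop ↔ ReachRule T V t := by
  cases t with
  | var n => exact absurd rfl (hvar n)
  | id => exact iff_false_intro not_reachesTop_id
  | bot => exact iff_false_intro not_reachesTop_bot
  | top => exact iff_true_intro reachesTop_top
  | meet s t =>
    obtain ⟨hs, ht⟩ := WarpTerm.code_lt_of_code_eq (u := .meet s t) rfl
    exact reachesTop_inf_iff.trans (and_congr (hsub s hs).reachesTop_iff (hsub t ht).reachesTop_iff)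
  | join s t =>
    obtain ⟨hs, ht⟩ := WarpTerm.code_lt_of_code_eq (u := .join s t) rfl
    exact reachesTop_sup_iff.trans (or_congr (hsub s hs).reachesTop_iff (hsub t ht).reachesTop_iff)
  | comp s t =>
    obtain ⟨hs, ht⟩ := WarpTerm.code_lt_of_code_eq (u := .comp s t) rfl
    exact reachesTop_comp_iff.trans
      (and_congr htop (or_congr (hsub s hs).reachesTop_iff (hsub t ht).reachesTop_iff))
  | ld s t =>
    obtain ⟨hs, ht⟩ := WarpTerm.code_lt_of_code_eq (u := .ld s t) rfl
    refine reachesTop_ld_iff.trans (and_congr ?_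
      (imp_congr ((hsub s hs).apply_top_eq_top_iff he) (hsub t ht).reachesTop_iff))
    rw [(hsub s hs).apply_top he, (hsub t ht).apply_top he,
      he.le_iff (hsub s hs).last_le (hsub t ht).last_le]
  | rd s t =>
    obtain ⟨hs, ht⟩ := WarpTerm.code_lt_of_code_eq (u := .rd s t) rfl
    exact reachesTop_rd_iff.trans (and_congr htop
      (imp_congr ((hsub t ht).approachesTop_iff he) (hsub s hs).reachesTop_iff))

theorem eval_apply_of_valueRule (hT : 0 < T) (hvar : ∀ n, t ≠ .var n)
    (hsub : ∀ s : WarpTerm, s.code < t.code → Tabulates (point T) T (V s) (s.eval θ))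
    (hp : p ≤ T) (hq : q ≤ T) (hrule : ValueRule T V p q t) :
    t.eval θ (point T p) = point T q := by
  have he := isScale_point hT
  cases t with
  | var n => exact absurd rfl (hvar n)
  | id => exact congrArg (point T) (Eq.symm hrule)
  | bot => exact he.map_zero.symm.trans (congrArg (point T) (Eq.symm hrule))
  | top => exact (he.top_apply_eq_iff hp hq).2 hrule
  | meet s t =>
    obtain ⟨hs, ht⟩ := WarpTerm.code_lt_of_code_eq (u := .meet s t) rfl
    obtain ⟨hsp, htp, rfl⟩ := hrule
    exact (hsub s hs).inf_apply he (hsub t ht) hp hsp htp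
  | join s t =>
    obtain ⟨hs, ht⟩ := WarpTerm.code_lt_of_code_eq (u := .join s t) rfl
    obtain ⟨hsp, htp, rfl⟩ := hrule
    exact (hsub s hs).sup_apply he (hsub t ht) hp hsp htp
  | comp s t =>
    obtain ⟨hs, ht⟩ := WarpTerm.code_lt_of_code_eq (u := .comp s t) rfl
    obtain ⟨htp, rfl⟩ := hrule
    exact (hsub s hs).comp_apply (hsub t ht) hp htp hq
  | ld s t =>
    obtain ⟨hs, ht⟩ := WarpTerm.code_lt_of_code_eq (u := .ld s t) rfl
    exact ld_apply_of_ldRule (hsub s hs) (hsub t ht) hT hp hq hrule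
  | rd s t =>
    obtain ⟨hs, ht⟩ := WarpTerm.code_lt_of_code_eq (u := .rd s t) rfl
    exact rd_apply_of_rdRule (hsub s hs) (hsub t ht) hT hp hq hrule

theorem IsCertificate.exists_tabulates {N : ℕ} (hV : IsCertificate N T V) :
    ∃ θ : ℕ → TimeWarp, ∀ t : WarpTerm, t.code ≤ N → Tabulates (point T) T (V t) (t.eval θ) := by
  obtain ⟨hT, hV⟩ := hV
  refine ⟨fun n => realize T (V (.var n)), fun t => ?_⟩
  induction hc : t.code using Nat.strong_induction_on generalizing t with
  | _ c ih =>
    subst hc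
    intro ht
    obtain ⟨hlast, hvalue, hreach⟩ := hV t ht
    by_cases hvar : ∃ n, t = .var n
    · obtain ⟨n, rfl⟩ := hvar
      exact tabulates_realize hvalue hlast
    · have hsub (s : WarpTerm) (hs : s.code < t.code) := ih _ hs s rfl (hs.le.trans ht)
      have happly {p : ℕ} (hp : p ≤ T) (hq : V t p ≤ T) := eval_apply_of_valueRule hT
        (not_exists.1 hvar) hsub hp hq (hvalue p hp hq)
      have he := isScale_point hT
      refine ⟨hlast, happly, (reachesTop_eval_iff he (not_exists.1 hvar) hsub ?_).trans hreach.symm⟩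
      rw [← he.map_top, happly le_rfl hlast, he.eq_iff hlast le_rfl]

end soundness

/-- The least point at which `f` is at least `x`; it is `⊤` if there is none. -/
noncomputable def leastGe (f : TimeWarp) (x : ℕ∞) : ℕ∞ := sInf {l | x ≤ f l}

theorem leastGe_le {f : TimeWarp} {x l : ℕ∞} (h : x ≤ f l) : leastGe f x ≤ l := sInf_le h

theorem apply_leastGe_apply_top (f : TimeWarp) : f (leastGe f (f ⊤)) = f ⊤ :=
  (f.mono le_top).antisymm (csInf_mem (s := {l | f ⊤ ≤ f l}) ⟨⊤, le_refl (f ⊤)⟩)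

theorem leastGe_eq_add_one {f : TimeWarp} {k x : ℕ∞} (hlt : f k < x) (hle : x ≤ f (k + 1)) :
    leastGe f x = k + 1 :=
  (leastGe_le hle).antisymm (le_sInf fun _ hl =>
    Order.add_one_le_of_lt (f.mono.reflect_lt (hlt.trans_le hl)))

/-- The points that have to be sampled to justify the values at `x` of terms built from `f`:
composition needs `f x`, the left residual also its successor, the right residual the least point
at which `f` is at least `x` and its predecessor. At `x = ⊤` the last point tells whether `f`
attains its supremum at a finite point. -/
noncomputable def probes (f : TimeWarp) (x : ℕ∞) : Finset ℕ∞ :=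
  {f x, f x + 1, leastGe f x, leastGe f x - 1, leastGe f (f x)}

/-- The points of `P` together with the probes at them of the members of `F`. -/
noncomputable def demand (F : Finset TimeWarp) (P : Finset ℕ∞) : Finset ℕ∞ :=
  P ∪ (F ×ˢ P).biUnion fun z => probes z.1 z.2

/-- The points reached from `0`, `⊤` and `x` in `k` rounds of sampling. -/
noncomputable def level (F : Finset TimeWarp) (x : ℕ∞) (k : ℕ) : Finset ℕ∞ :=
  (demand F)^[k] {0, ⊤, x}

section level

variable {F : Finset TimeWarp} {P : Finset ℕ∞} {f : TimeWarp} {x y : ℕ∞} {k m : ℕ}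

theorem subset_demand : P ⊆ demand F P := Finset.subset_union_left

theorem mem_demand_of_mem_probes (hf : f ∈ F) (hx : x ∈ P) (hy : y ∈ probes f x) :
    y ∈ demand F P :=
  Finset.mem_union_right _ (Finset.mem_biUnion.2 ⟨(f, x), Finset.mk_mem_product hf hx, hy⟩)

theorem card_demand_le : (demand F P).card ≤ P.card * (5 * F.card + 1) := by
  have hprobes : ((F ×ˢ P).biUnion fun z => probes z.1 z.2).card ≤ (F ×ˢ P).card * 5 :=
    Finset.card_biUnion_le_card_mul _ _ _ fun _ _ => Finset.card_le_five
  calc (demand F P).card ≤ P.card + F.card * P.card * 5 :=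
        (Finset.card_union_le _ _).trans (by rw [Finset.card_product] at hprobes; omega)
    _ = P.card * (5 * F.card + 1) := by ring

theorem level_succ : level F x (k + 1) = demand F (level F x k) :=
  Function.iterate_succ_apply' _ _ _

theorem level_mono : Monotone (level F x) :=
  monotone_nat_of_le_succ fun _ => level_succ.symm ▸ subset_demand

theorem subset_level : {0, ⊤, x} ⊆ level F x k := level_mono k.zero_le

theorem card_level_le : (level F x k).card ≤ 3 * (5 * F.card + 1) ^ k := by
  induction k with
  | zero => exact Finset.card_le_three
  | succ k ih =>
    rw [level_succ, pow_succ, ← mul_assoc]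
    exact card_demand_le.trans (Nat.mul_le_mul_right _ ih)

end level

theorem exists_isScale {S : Finset ℕ∞} (hzero : 0 ∈ S) (htop : ⊤ ∈ S) :
    ∃ e : ℕ → ℕ∞, IsScale (S.card - 1) e ∧ ∀ x ∈ S, ∃ p ≤ S.card - 1, e p = x := by
  have hpos : 0 < S.card := Finset.card_pos.2 ⟨0, hzero⟩
  refine ⟨fun p => if hp : p < S.card then S.orderEmbOfFin rfl ⟨p, hp⟩ else ⊤, ⟨?_, ?_, ?_⟩, ?_⟩
  · rw [dif_pos hpos, Finset.orderEmbOfFin_zero rfl hpos]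
    exact nonpos_iff_eq_zero.1 (Finset.min'_le _ _ hzero)
  · rw [dif_pos (by omega), Finset.orderEmbOfFin_last rfl hpos]
    exact top_le_iff.1 (Finset.le_max' _ _ htop)
  · intro p (hp : p ≤ _) q (hq : q ≤ _) hpq
    dsimp only
    rw [dif_pos (by omega), dif_pos (by omega)]
    exact (S.orderEmbOfFin rfl).strictMono hpq
  · intro x hx
    obtain ⟨⟨p, hp⟩, rfl⟩ : x ∈ Set.range (S.orderEmbOfFin rfl) := by
      rwa [Finset.range_orderEmbOfFin]
    exact ⟨p, by omega, dif_pos hp⟩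

/-- Along the scale `e`, the defined entries of the row `U` are the values of `f` at the points
of `P`. -/
structure Samples (e : ℕ → ℕ∞) (T : ℕ) (P : Finset ℕ∞) (f : TimeWarp) (U : ℕ → ℕ) : Prop where
  le_iff : ∀ {p : ℕ}, p ≤ T → (U p ≤ T ↔ e p ∈ P)
  apply_eq : ∀ {p : ℕ}, p ≤ T → U p ≤ T → f (e p) = e (U p)

theorem exists_samples {e : ℕ → ℕ∞} {T : ℕ} {P : Finset ℕ∞} {f : TimeWarp}
    (hP : ∀ x ∈ P, ∃ q ≤ T, e q = f x) :
    ∃ U : ℕ → ℕ, (∀ p, U p < T + 2) ∧ Samples e T P f U := by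
  classical
  choose q hqT hq using hP
  refine ⟨fun p => if hp : e p ∈ P then q _ hp else T + 1, fun p => ?_, fun {p} _ => ?_,
    fun {p} _ hU => ?_⟩
  · dsimp only
    split_ifs with hp
    · exact (hqT _ hp).trans_lt (by omega)
    · omega
  · split_ifs with hp <;> simp [hp, hqT]
  · split_ifs at hU ⊢ with hp
    · exact (hq _ hp).symm
    · omega

namespace Samples

variable {e : ℕ → ℕ∞} {T : ℕ} {P : Finset ℕ∞} {f : TimeWarp} {U : ℕ → ℕ} {p : ℕ}

theorem exists_lt_eq_last (he : IsScale T e) (hU : Samples e T P f U) (hlast : U T ≤ T)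
    (hleast : ∃ m ≤ T, e m = leastGe f (f ⊤) ∧ U m ≤ T) {n : ℕ} (hn : f n = f ⊤) :
    ∃ m < T, U m = U T := by
  obtain ⟨m, hm, hem, hUm⟩ := hleast
  have hne : e m ≠ ⊤ := (((hem.trans_le (leastGe_le hn.ge))).trans_lt (ENat.natCast_lt_top n)).ne
  refine ⟨m, hm.lt_of_ne ((he.eq_top_iff hm).not.1 hne), (he.eq_iff hUm hlast).1 ?_⟩
  rw [← hU.apply_eq hm hUm, hem, apply_leastGe_apply_top, ← hU.apply_eq le_rfl hlast, he.map_top]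

theorem tabulates (he : IsScale T e) (hU : Samples e T P f U) (hlast : U T ≤ T)
    (hleast : ∃ m ≤ T, e m = leastGe f (f ⊤) ∧ U m ≤ T) : Tabulates e T U f where
  last_le := hlast
  apply_eq := hU.apply_eq
  reachesTop_iff := by
    constructor
    · intro hf
      obtain ⟨n, hn⟩ := id hf
      have hT : U T = T := by
        rw [← he.eq_top_iff hlast, ← hU.apply_eq le_rfl hlast, he.map_top, hf.apply_top]
      rw [Reaches, ← hT, hT]
      simpa [hT] using hU.exists_lt_eq_last he hlast hleast (hn.trans hf.apply_top.symm)
    · rintro ⟨m, hm, hUm⟩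
      lift e m to ℕ using (he.lt_top hm).ne with n hn
      exact ⟨n, by rw [hn, hU.apply_eq hm.le hUm.le, hUm, he.map_top]⟩

theorem varRule (he : IsScale T e) (hU : Samples e T P f U)
    (hleast : ∃ m ≤ T, e m = leastGe f (f ⊤) ∧ U m ≤ T) (hp : p ≤ T) (hUp : U p ≤ T) :
    VarRule T U p (U p) := by
  refine ⟨?_, fun m hm hUm => ?_, ?_⟩
  · rintro rfl
    rw [← he.eq_zero_iff hUp, ← hU.apply_eq hp hUp, he.map_zero, apply_zero]
  · have hmT : m ≤ T := hm.le.trans hp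
    rw [← he.le_iff hUm hUp, ← hU.apply_eq hmT hUm, ← hU.apply_eq hp hUp]
    exact f.mono ((he.le_iff hmT hp).2 hm.le)
  · rintro rfl
    refine or_iff_not_imp_left.2 fun hne => ?_
    have hf : f ⊤ ≠ ⊤ := by rwa [← he.map_top, hU.apply_eq hp hUp, ne_eq, he.eq_iff hUp hp]
    obtain ⟨n, -, hn⟩ := exists_le_apply hf le_rfl
    exact hU.exists_lt_eq_last he hUp hleast ((f.mono le_top).antisymm hn)

end Samples

section completeness

variable {e : ℕ → ℕ∞} {T : ℕ} {A B : ℕ → ℕ} {f g h : TimeWarp} {p q : ℕ}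

theorem ldRule_of_ld_apply (he : IsScale T e) (hA : Tabulates e T A f) (hB : Tabulates e T B h)
    (hp : p ≤ T) (hq : q ≤ T) (hBp : B p ≤ T) (hAq : A q ≤ T)
    (hsucc : ∃ m ≤ T, e m = e q + 1 ∧ A m ≤ T) (heq : ld f h (e p) = e q) :
    LdRule T A B p q := by
  obtain rfl | hp0 := eq_or_ne p 0
  · rw [he.map_zero, apply_zero] at heq
    exact .inl ⟨rfl, (he.eq_zero_iff hq).1 heq.symm⟩
  · obtain ⟨m, hm, hem, hAm⟩ := hsucc
    have hnext (hlt : q < T) : m = q + 1 := he.eq_add_one hlt hm hem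
    refine .inr ⟨hp0, hBp, hAq, fun hlt => ?_, (hA.ld_apply_eq_iff he hB hp hp0 hq hBp hAq
      fun hlt => hnext hlt ▸ ⟨hAm, hem⟩).1 heq⟩
    refine hnext hlt ▸ ⟨hm.lt_of_ne fun hmT => ?_, hAm⟩
    have hlt := he.lt_top hlt
    rw [hmT, he.map_top] at hem
    exact (WithTop.add_lt_top.2 ⟨hlt, ENat.one_lt_top⟩).ne hem.symm

theorem rdRule_of_rd_apply (he : IsScale T e) (hA : Tabulates e T A h) (hB : Tabulates e T B g)
    (hp : p ≤ T) (hq : q ≤ T)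
    (hprobes : ∀ x ∈ probes g (e p), ∃ m ≤ T, e m = x ∧ A m ≤ T ∧ B m ≤ T)
    (heq : rd h g (e p) = e q) : RdRule T A B p q := by
  obtain rfl | hp0 := eq_or_ne p 0
  · rw [he.map_zero, apply_zero] at heq
    exact .inl ⟨rfl, (he.eq_zero_iff hq).1 heq.symm⟩
  refine .inr ?_
  obtain hgt | hle := lt_or_ge (g ⊤) (e p)
  · rw [rd_apply_eq_top hgt, eq_comm, he.eq_top_iff hq] at heq
    rw [hB.apply_top he, he.lt_iff hB.last_le hp] at hgt
    exact .inl ⟨hgt, heq⟩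
  refine .inr ?_
  by_cases hlim : e p = ⊤ ∧ g.ApproachesTop
  · rw [hlim.1, rd_apply_top hlim.2, hA.apply_top he, he.eq_iff hA.last_le hq] at heq
    exact .inl ⟨(he.eq_top_iff hp).1 hlim.1, (hB.approachesTop_iff he).1 hlim.2, heq.symm⟩
  refine .inr ?_
  obtain ⟨n, hlt, hle⟩ :=
    exists_apply_lt_le_apply_add_one ((he.eq_zero_iff hp).not.2 hp0) hle hlim
  have hleast : leastGe g (e p) = n + 1 := leastGe_eq_add_one hlt hle
  obtain ⟨m, hm, hem, hAm, hBm⟩ := hprobes (n + 1) (by simp [probes, hleast])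
  have hpred : leastGe g (e p) - 1 = n := by
    rw [hleast]
    exact mod_cast n.add_sub_cancel (m := 1)
  obtain ⟨k, hk, hek, -, hBk⟩ := hprobes n (by simp [probes, hpred])
  have hkT : k < T := hk.lt_of_ne fun hkT => by simp [hkT, he.map_top] at hek
  obtain rfl : m = k + 1 := he.eq_add_one hkT hm (hem.trans (by rw [hek]))
  refine ⟨k, hkT, hm.lt_of_ne fun hmT => ?_, ?_, ?_, hBm, ?_⟩
  · rw [hmT, he.map_top] at hem
    exact ENat.natCast_ne_top (n + 1) hem.symm
  · rwa [← hek, hB.apply_eq hk hBk, he.lt_iff hBk hp] at hlt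
  · rwa [← hem, hB.apply_eq hm hBm, he.le_iff hp hBm] at hle
  · rwa [rd_apply_eq hlt hle, ← hem, hA.apply_eq hm hAm, he.eq_iff hAm hq, eq_comm] at heq

end completeness

section certificate

variable {e : ℕ → ℕ∞} {N T : ℕ} {F : Finset TimeWarp} {V : WarpTerm → ℕ → ℕ}
  {θ : ℕ → TimeWarp} {t : WarpTerm} {x : ℕ∞} {p : ℕ}

theorem valueRule_of_eval_apply (he : IsScale T e) (hvar : ∀ n, t ≠ .var n)
    (hsub : ∀ s : WarpTerm, s.code < t.code → Tabulates e T (V s) (s.eval θ))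
    (hself : ∀ s : WarpTerm, s.code < t.code → V s p ≤ T)
    (hprobes : ∀ s : WarpTerm, s.code ≤ t.code → ∀ y ∈ probes (s.eval θ) (e p),
      ∃ m ≤ T, e m = y ∧ ∀ u : WarpTerm, u.code < t.code → V u m ≤ T)
    (hp : p ≤ T) {q : ℕ} (hq : q ≤ T) (heq : t.eval θ (e p) = e q) : ValueRule T V p q t := by
  have hvalue {s u : WarpTerm} (hs : s.code ≤ t.code) (hu : u.code < t.code) {m : ℕ} (hm : m ≤ T)
      (hem : s.eval θ (e p) = e m) : V u m ≤ T := by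
    obtain ⟨k, hk, hek, hV⟩ := hprobes s hs (e m) (by simp [probes, hem])
    exact (he.eq_iff hk hm).1 hek ▸ hV u hu
  cases t with
  | var n => exact absurd rfl (hvar n)
  | id => exact ((he.eq_iff hp hq).1 heq).symm
  | bot => exact (he.eq_zero_iff hq).1 (Eq.symm heq)
  | top => exact (he.top_apply_eq_iff hp hq).1 heq
  | meet s t =>
    obtain ⟨hs, ht⟩ := WarpTerm.code_lt_of_code_eq (u := .meet s t) rfl
    refine ⟨hself s hs, hself t ht, ?_⟩
    rw [← he.eq_iff hq (min_le_of_left_le (hself s hs)), ← heq]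
    exact (hsub s hs).inf_apply he (hsub t ht) hp (hself s hs) (hself t ht)
  | join s t =>
    obtain ⟨hs, ht⟩ := WarpTerm.code_lt_of_code_eq (u := .join s t) rfl
    refine ⟨hself s hs, hself t ht, ?_⟩
    rw [← he.eq_iff hq (max_le (hself s hs) (hself t ht)), ← heq]
    exact (hsub s hs).sup_apply he (hsub t ht) hp (hself s hs) (hself t ht)
  | comp s t =>
    obtain ⟨hs, ht⟩ := WarpTerm.code_lt_of_code_eq (u := .comp s t) rfl
    have hst : V s (V t p) ≤ T :=
      hvalue ht.le hs (hself t ht) ((hsub t ht).apply_eq hp (hself t ht))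
    refine ⟨hself t ht, ?_⟩
    rw [← he.eq_iff hq hst, ← heq]
    exact (hsub s hs).comp_apply (hsub t ht) hp (hself t ht) hst
  | ld s t =>
    obtain ⟨hs, ht⟩ := WarpTerm.code_lt_of_code_eq (u := .ld s t) rfl
    obtain ⟨m, hm, hem, hVm⟩ := hprobes _ le_rfl (e q + 1) (by simp [probes, heq])
    exact ldRule_of_ld_apply he (hsub s hs) (hsub t ht) hp hq (hself t ht) (hvalue le_rfl hs hq heq)
      ⟨m, hm, hem, hVm s hs⟩ heq
  | rd s t =>
    obtain ⟨hs, ht⟩ := WarpTerm.code_lt_of_code_eq (u := .rd s t) rfl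
    refine rdRule_of_rd_apply he (hsub s hs) (hsub t ht) hp hq (fun y hy => ?_) heq
    obtain ⟨m, hm, hem, hVm⟩ := hprobes t ht.le y hy
    exact ⟨m, hm, hem, hVm s hs, hVm t ht⟩

theorem isCertificate_of_samples (he : IsScale T e)
    (hrange : ∀ y ∈ level F x (N + 2), ∃ m ≤ T, e m = y)
    (hF : ∀ t : WarpTerm, t.code ≤ N → t.eval θ ∈ F)
    (hV : ∀ t : WarpTerm, t.code ≤ N →
      Samples e T (level F x (N + 1 - t.code)) (t.eval θ) (V t)) :
    IsCertificate N T V := by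
  have hlast {t : WarpTerm} (ht : t.code ≤ N) : V t T ≤ T :=
    ((hV t ht).le_iff le_rfl).2 (he.map_top ▸ subset_level (by simp))
  have hleast {t : WarpTerm} (ht : t.code ≤ N) :
      ∃ m ≤ T, e m = leastGe (t.eval θ) (t.eval θ ⊤) ∧ V t m ≤ T := by
    have hmem : leastGe (t.eval θ) (t.eval θ ⊤) ∈ level F x 1 :=
      mem_demand_of_mem_probes (hF t ht) (x := ⊤) (by simp) (by simp [probes])
    obtain ⟨m, hm, hem⟩ := hrange _ (level_mono (by omega) hmem)
    exact ⟨m, hm, hem, ((hV t ht).le_iff hm).2 (hem ▸ level_mono (by omega) hmem)⟩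
  have htab {t : WarpTerm} (ht : t.code ≤ N) : Tabulates e T (V t) (t.eval θ) :=
    (hV t ht).tabulates he (hlast ht) (hleast ht)
  refine ⟨he.pos, fun t ht => ⟨hlast ht, ?_⟩⟩
  by_cases hvar : ∃ n, t = .var n
  · obtain ⟨n, rfl⟩ := hvar
    exact ⟨fun p hp hVp => (hV _ ht).varRule he (hleast ht) hp hVp, Iff.rfl⟩
  · have hsub (s : WarpTerm) (hs : s.code < t.code) := htab (hs.le.trans ht)
    refine ⟨fun p hp hVp => ?_, (htab ht).reachesTop_iff.symm.trans
      (reachesTop_eval_iff he (not_exists.1 hvar) hsub ((htab ht).apply_top_eq_top_iff he))⟩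
    have hpP : e p ∈ level F x (N + 1 - t.code) := ((hV t ht).le_iff hp).1 hVp
    refine valueRule_of_eval_apply he (not_exists.1 hvar) hsub
      (fun s hs => ((hV s (hs.le.trans ht)).le_iff hp).2 (level_mono (by omega) hpP))
      (fun s hs y hy => ?_) hp hVp ((hV t ht).apply_eq hp hVp)
    have hyP := mem_demand_of_mem_probes (hF s (hs.trans ht)) hpP hy
    rw [← level_succ] at hyP
    obtain ⟨m, hm, rfl⟩ := hrange y (level_mono (by omega) hyP)
    exact ⟨m, hm, rfl, fun u hu => ((hV u (hu.le.trans ht)).le_iff hm).2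
      (level_mono (by omega) hyP)⟩

end certificate

/-- The table encoded by `c`: the entries are the digits of `c` in base `T + 2`, the digit `T + 1`
being the undefined entry. -/
def decode (T c : ℕ) (t : WarpTerm) (p : ℕ) : ℕ := c / (T + 2) ^ Nat.pair t.code p % (T + 2)

theorem exists_digits_eq {b n : ℕ} {d : ℕ → ℕ} (hd : ∀ i, d i < b) :
    ∃ c < b ^ n, ∀ i < n, c / b ^ i % b = d i := by
  let c := finFunctionFinEquiv fun i : Fin n => (⟨d i, hd i⟩ : Fin b)
  refine ⟨c, c.isLt, fun i hi => ?_⟩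
  exact congrArg Fin.val (congrFun (finFunctionFinEquiv.symm_apply_apply
    fun i : Fin n => (⟨d i, hd i⟩ : Fin b)) ⟨i, hi⟩)

theorem exists_decode_eq {T : ℕ} {U : WarpTerm → ℕ → ℕ} (hU : ∀ t p, U t p < T + 2) (N : ℕ) :
    ∃ c < (T + 2) ^ ((N + T + 1) ^ 2), ∀ t : WarpTerm, t.code ≤ N → ∀ p ≤ T,
      decode T c t p = U t p := by
  obtain ⟨c, hc, hdigit⟩ := exists_digits_eq (n := (N + T + 1) ^ 2)
    fun i => hU (.ofCode i.unpair.1) i.unpair.2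
  refine ⟨c, hc, fun t ht p hp => ?_⟩
  have hlt : Nat.pair t.code p < (N + T + 1) ^ 2 :=
    (Nat.pair_lt_max_add_one_sq _ _).trans_le (Nat.pow_le_pow_left (by omega) 2)
  rw [decode, hdigit _ hlt, Nat.unpair_pair, WarpTerm.ofCode_code]

theorem exists_decode_samples {e : ℕ → ℕ∞} {T N : ℕ} {P : WarpTerm → Finset ℕ∞}
    {f : WarpTerm → TimeWarp}
    (hP : ∀ t : WarpTerm, t.code ≤ N → ∀ y ∈ P t, ∃ q ≤ T, e q = f t y) :
    ∃ c < (T + 2) ^ ((N + T + 1) ^ 2), ∀ t : WarpTerm, t.code ≤ N →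
      Samples e T (P t) (f t) (decode T c t) := by
  have hrow (t : WarpTerm) :
      ∃ U : ℕ → ℕ, (∀ p, U p < T + 2) ∧ (t.code ≤ N → Samples e T (P t) (f t) U) := by
    by_cases ht : t.code ≤ N
    · exact (exists_samples (hP t ht)).imp fun U hU => ⟨hU.1, fun _ => hU.2⟩
    · exact ⟨0, fun _ => Nat.succ_pos _, fun h => absurd h ht⟩
  choose U hUlt hU using hrow
  obtain ⟨c, hc, hdecode⟩ := exists_decode_eq hUlt N
  exact ⟨c, hc, fun t ht => ⟨fun hp => hdecode t ht _ hp ▸ (hU t ht).le_iff hp,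
    fun hp => hdecode t ht _ hp ▸ (hU t ht).apply_eq hp⟩⟩

/-- A bound on the number of points of the certificates needed for terms with Gödel number at
most `N`. -/
def certificateBound (N : ℕ) : ℕ := 3 * (5 * (N + 1) + 1) ^ (N + 2)

theorem exists_isCertificate (θ : ℕ → TimeWarp) (x : ℕ∞) (N : ℕ) :
    ∃ T < certificateBound N, ∃ e : ℕ → ℕ∞, ∃ c < (T + 2) ^ ((N + T + 1) ^ 2), ∃ p ≤ T,
      e p = x ∧ IsCertificate N T (decode T c) ∧ ∀ t : WarpTerm, t.code ≤ N →
        decode T c t p ≤ T ∧ t.eval θ x = e (decode T c t p) := by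
  classical
  let F := (Finset.range (N + 1)).image fun u => (WarpTerm.ofCode u).eval θ
  have hF (t : WarpTerm) (ht : t.code ≤ N) : t.eval θ ∈ F := Finset.mem_image.2
    ⟨t.code, Finset.mem_range_succ_iff.2 ht, by rw [WarpTerm.ofCode_code]⟩
  have hFcard : F.card ≤ N + 1 := Finset.card_image_le.trans_eq (Finset.card_range _)
  obtain ⟨e, he, hrange⟩ := exists_isScale (S := level F x (N + 2))
    (subset_level (by simp)) (subset_level (by simp))
  set T := (level F x (N + 2)).card - 1
  have hT : T < certificateBound N := by
    have hcard : (level F x (N + 2)).card ≤ certificateBound N := card_level_le.trans <|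
      Nat.mul_le_mul_left _ (Nat.pow_le_pow_left (by omega) _)
    have := he.pos
    omega
  obtain ⟨c, hc, hV⟩ := exists_decode_samples (e := e) (T := T) (N := N)
    (P := fun t => level F x (N + 1 - t.code)) (f := fun t => t.eval θ) fun t ht y hy => by
      have hmem := mem_demand_of_mem_probes (y := t.eval θ y) (hF t ht) hy (by simp [probes])
      rw [← level_succ] at hmem
      exact hrange _ (level_mono (by omega) hmem)
  obtain ⟨p, hp, rfl⟩ := hrange x (subset_level (by simp))
  refine ⟨T, hT, e, c, hc, p, hp, rfl, isCertificate_of_samples he hrange hF hV, fun t ht => ?_⟩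
  have hdef : decode T c t p ≤ T := ((hV t ht).le_iff hp).2 (subset_level (by simp))
  exact ⟨hdef, (hV t ht).apply_eq hp hdef⟩

/-- The number `c` codes a certificate over the points `0, …, T` in which the two sides of the
equation `e` have distinct entries at some point. -/
def IsRefutation (e : WarpTerm × WarpTerm) (T c : ℕ) : Prop :=
  IsCertificate (e.1.code + e.2.code) T (decode T c) ∧ ∃ p < T + 1,
    decode T c e.1 p ≤ T ∧ decode T c e.2 p ≤ T ∧ decode T c e.1 p ≠ decode T c e.2 p

theorem not_models_iff {e : WarpTerm × WarpTerm} :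
    ¬ Models e ↔ ∃ T < certificateBound (e.1.code + e.2.code),
      ∃ c < (T + 2) ^ ((e.1.code + e.2.code + T + 1) ^ 2), IsRefutation e T c := by
  obtain ⟨s, t⟩ := e
  constructor
  · intro hne
    obtain ⟨θ, hθ⟩ := not_forall.1 hne
    obtain ⟨x, hx⟩ := DFunLike.ne_iff.1 hθ
    obtain ⟨T, hT, e, c, hc, p, hp, -, hcert, hvalue⟩ := exists_isCertificate θ x (s.code + t.code)
    obtain ⟨hs, hsx⟩ := hvalue s (by omega)
    obtain ⟨ht, htx⟩ := hvalue t (by omega)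
    exact ⟨T, hT, c, hc, hcert, p, Nat.lt_succ_of_le hp, hs, ht,
      fun heq => hx (by rw [hsx, htx, heq])⟩
  · rintro ⟨T, -, c, -, hcert, p, hp, hs, ht, hne⟩ hmodels
    obtain ⟨θ, hθ⟩ := hcert.exists_tabulates
    have hpT : p ≤ T := Nat.le_of_lt_succ hp
    refine hne (((isScale_point hcert.1).eq_iff hs ht).1 ?_)
    rw [← (hθ s (Nat.le_add_right ..)).apply_eq hpT hs,
      ← (hθ t (Nat.le_add_left ..)).apply_eq hpT ht]
    exact congrArg (· (point T p)) (hmodels θ)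

end TimeWarp

namespace WarpTerm

theorem code_injective : Function.Injective code := Function.LeftInverse.injective ofCode_code

/-- The immediate data of a term: the index of a variable, and for a composite term the pair of the
Gödel numbers of its two arguments. -/
def payload (t : WarpTerm) : ℕ := (t.code - 3) / 6

/-- The first argument of a composite term. -/
def fstArg (t : WarpTerm) : WarpTerm := ofCode t.payload.unpair.1

/-- The second argument of a composite term. -/
def sndArg (t : WarpTerm) : WarpTerm := ofCode t.payload.unpair.2

theorem payload_eq {t : WarpTerm} {n r : ℕ} (hr : r < 6) (ht : t.code = 6 * n + (r + 3)) :
    t.payload = n := by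
  rw [payload, ht]
  omega

theorem args_eq {s t u : WarpTerm} {r : ℕ} (hr : r < 6)
    (hu : u.code = 6 * Nat.pair s.code t.code + (r + 3)) : u.fstArg = s ∧ u.sndArg = t := by
  simp only [fstArg, sndArg, payload_eq hr hu, Nat.unpair_pair, ofCode_code, and_self]

theorem eq_constructor (t : WarpTerm) :
    t = id ∨ t = bot ∨ t = top ∨ t = var t.payload ∨ t = meet t.fstArg t.sndArg ∨
      t = join t.fstArg t.sndArg ∨ t = comp t.fstArg t.sndArg ∨ t = ld t.fstArg t.sndArg ∨
      t = rd t.fstArg t.sndArg := by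
  cases t with
  | var n => simp [payload_eq (t := var n) (r := 0) (by omega) rfl]
  | id => simp
  | bot => simp
  | top => simp
  | meet s t => simp [args_eq (u := meet s t) (r := 1) (by omega) rfl]
  | join s t => simp [args_eq (u := join s t) (r := 2) (by omega) rfl]
  | comp s t => simp [args_eq (u := comp s t) (r := 3) (by omega) rfl]
  | ld s t => simp [args_eq (u := ld s t) (r := 4) (by omega) rfl]
  | rd s t => simp [args_eq (u := rd s t) (r := 5) (by omega) rfl]

section primrec

open Primrec

theorem primrec_code : Primrec code := Primrec.encode

theorem primrec_ofCode : Primrec ofCode := Primrec.ofNat WarpTerm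

theorem primrec_payload : Primrec payload :=
  nat_div.comp (nat_sub.comp primrec_code (const 3)) (const 6)

theorem primrec_fstArg : Primrec fstArg :=
  primrec_ofCode.comp (fst.comp (unpair.comp primrec_payload))

theorem primrec_sndArg : Primrec sndArg :=
  primrec_ofCode.comp (snd.comp (unpair.comp primrec_payload))

theorem primrec_var : Primrec var :=
  (primrec_ofCode.comp (nat_add.comp (nat_mul.comp (const 6) .id) (const 3))).of_eq fun n =>
    ofCode_code (var n)

theorem primrec₂_of_code_eq {op : WarpTerm → WarpTerm → WarpTerm} (r : ℕ)
    (hop : ∀ s t, (op s t).code = 6 * Nat.pair s.code t.code + r) : Primrec₂ op :=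
  (primrec_ofCode.comp (nat_add.comp (nat_mul.comp (const 6) (Primrec₂.natPair.comp
    (primrec_code.comp fst) (primrec_code.comp snd))) (const r))).of_eq fun x => by
      rw [← hop, ofCode_code]

variable {α : Type*} [Primcodable α] {P : α → WarpTerm → Prop}

theorem primrecPred_eq_and {u : α × WarpTerm → WarpTerm} (hu : Primrec u)
    (hP : PrimrecPred fun x : α × WarpTerm => P x.1 (u x)) :
    PrimrecPred fun x : α × WarpTerm => x.2 = u x ∧ P x.1 x.2 :=
  ((Primrec.eq.comp (primrec_code.comp snd) (primrec_code.comp hu)).and hP).of_eq fun x => by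
    rw [code_injective.eq_iff]
    exact and_congr_right fun h => by rw [← h]

theorem primrecRel_of_constructors (hvar : PrimrecRel fun (a : α) n => P a (var n))
    (hid : PrimrecPred fun a => P a id) (hbot : PrimrecPred fun a => P a bot)
    (htop : PrimrecPred fun a => P a top)
    (hmeet : PrimrecPred fun x : α × WarpTerm × WarpTerm => P x.1 (meet x.2.1 x.2.2))
    (hjoin : PrimrecPred fun x : α × WarpTerm × WarpTerm => P x.1 (join x.2.1 x.2.2))
    (hcomp : PrimrecPred fun x : α × WarpTerm × WarpTerm => P x.1 (comp x.2.1 x.2.2))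
    (hld : PrimrecPred fun x : α × WarpTerm × WarpTerm => P x.1 (ld x.2.1 x.2.2))
    (hrd : PrimrecPred fun x : α × WarpTerm × WarpTerm => P x.1 (rd x.2.1 x.2.2)) :
    PrimrecRel P := by
  have hargs := (primrec_fstArg.pair primrec_sndArg).comp (snd (α := α))
  have hbinary {op : WarpTerm → WarpTerm → WarpTerm} {r : ℕ}
      (hop : ∀ s t, (op s t).code = 6 * Nat.pair s.code t.code + r)
      (h : PrimrecPred fun x : α × WarpTerm × WarpTerm => P x.1 (op x.2.1 x.2.2)) :=
    primrecPred_eq_and ((primrec₂_of_code_eq r hop).comp (fst.comp hargs) (snd.comp hargs))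
      (h.comp (fst.pair hargs))
  have hpayload := primrec_payload.comp (snd (α := α))
  refine PrimrecPred.of_eq ((primrecPred_eq_and (const id) (hid.comp fst)).or <|
    (primrecPred_eq_and (const bot) (hbot.comp fst)).or <|
    (primrecPred_eq_and (const top) (htop.comp fst)).or <|
    (primrecPred_eq_and (primrec_var.comp hpayload) (hvar.comp fst hpayload)).or <|
    (hbinary (fun _ _ => rfl) hmeet).or <| (hbinary (fun _ _ => rfl) hjoin).or <|
    (hbinary (fun _ _ => rfl) hcomp).or <| (hbinary (fun _ _ => rfl) hld).or <|
    hbinary (fun _ _ => rfl) hrd) fun x => ?_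
  simp only [← or_and_right]
  exact and_iff_right (eq_constructor x.2)

end primrec

end WarpTerm

namespace TimeWarp

section primrec

open Primrec

variable {α β : Type*} [Primcodable α] [Primcodable β]

theorem primrecPred_imp {P Q : α → Prop} (hP : PrimrecPred P) (hQ : PrimrecPred Q) :
    PrimrecPred fun a => P a → Q a :=
  (hP.not.or hQ).of_eq fun _ => imp_iff_not_or.symm

theorem primrecPred_iff {P Q : α → Prop} (hP : PrimrecPred P) (hQ : PrimrecPred Q) :
    PrimrecPred fun a => P a ↔ Q a :=
  ((primrecPred_imp hP hQ).and (primrecPred_imp hQ hP)).of_eq fun _ => iff_def.symm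

theorem primrecPred_exists_lt {b : α → ℕ} {R : α → ℕ → Prop} (hb : Primrec b)
    (hR : PrimrecRel R) : PrimrecPred fun a => ∃ m < b a, R a m :=
  ((PrimrecRel.exists_mem_list (R := fun m a => R a m) hR.swap).comp (list_range.comp hb) .id).of_eq
    fun _ => by simp only [List.mem_range, id_eq]

theorem primrecPred_forall_lt {b : α → ℕ} {R : α → ℕ → Prop} (hb : Primrec b)
    (hR : PrimrecRel R) : PrimrecPred fun a => ∀ m < b a, R a m :=
  ((PrimrecRel.forall_mem_list (R := fun m a => R a m) hR.swap).comp (list_range.comp hb) .id).of_eq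
    fun _ => by simp only [List.mem_range, id_eq]

theorem primrecPred_forall_le {b : α → ℕ} {R : α → ℕ → Prop} (hb : Primrec b)
    (hR : PrimrecRel R) : PrimrecPred fun a => ∀ m ≤ b a, R a m :=
  (primrecPred_forall_lt (succ.comp hb) hR).of_eq fun _ => by simp only [Nat.lt_succ_iff]

theorem primrec₂_pow : Primrec₂ ((· ^ ·) : ℕ → ℕ → ℕ) := Primrec₂.unpaired'.1 Nat.Primrec.pow

theorem primrec_add_const {u : α → ℕ} (hu : Primrec u) (k : ℕ) : Primrec fun a => u a + k :=
  nat_add.comp hu (const k)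

theorem primrecPred_const (P : Prop) : PrimrecPred fun _ : α => P := by
  classical
  exact ⟨inferInstance, const (decide P)⟩

variable {T p q : α → ℕ} {A B U : α → ℕ → ℕ}

theorem primrecPred_reaches (hT : Primrec T) (hU : Primrec₂ U) :
    PrimrecPred fun a => Reaches (T a) (U a) :=
  primrecPred_exists_lt hT (Primrec.eq.comp hU (hT.comp fst))

theorem primrecPred_approaches (hT : Primrec T) (hU : Primrec₂ U) :
    PrimrecPred fun a => Approaches (T a) (U a) :=
  (Primrec.eq.comp (hU.comp .id hT) hT).and (primrecPred_reaches hT hU).not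

theorem primrecPred_ldSpec (hT : Primrec T) (hA : Primrec₂ A) (hB : Primrec₂ B) (hp : Primrec p)
    (hq : Primrec q) : PrimrecPred fun a => LdSpec (T a) (A a) (B a) (p a) (q a) := by
  have hlim : PrimrecPred fun a => p a = T a ∧ Approaches (T a) (B a) :=
    (Primrec.eq.comp hp hT).and (primrecPred_approaches hT hB)
  have hqT := nat_lt.comp hq hT
  have hAq := hA.comp .id hq
  have hAq' := hA.comp .id (primrec_add_const hq 1)
  have hBp := hB.comp .id hp
  refine (primrecPred_imp hlim (.or ?_ ?_)).and (primrecPred_imp hlim.not (.and ?_ ?_))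
  · exact (primrecPred_reaches hT hA).not.and (Primrec.eq.comp hq hT)
  · exact hqT.and ((nat_lt.comp hAq hT).and (Primrec.eq.comp hAq' hT))
  · exact nat_le.comp hAq hBp
  · exact primrecPred_imp hqT (nat_lt.comp hBp hAq')

theorem primrecPred_varRule (hT : Primrec T) (hU : Primrec₂ U) (hp : Primrec p) (hq : Primrec q) :
    PrimrecPred fun a => VarRule (T a) (U a) (p a) (q a) := by
  refine .and ?_ (.and (primrecPred_forall_lt hp ?_) (primrecPred_imp (Primrec.eq.comp hp hT)
    (.or (Primrec.eq.comp hq hT) (primrecPred_exists_lt hT ?_))))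
  · exact primrecPred_imp (Primrec.eq.comp hp (const 0)) (Primrec.eq.comp hq (const 0))
  · exact primrecPred_imp (nat_le.comp hU (hT.comp fst)) (nat_le.comp hU (hq.comp fst))
  · exact Primrec.eq.comp hU (hq.comp fst)

theorem primrecPred_ldRule (hT : Primrec T) (hA : Primrec₂ A) (hB : Primrec₂ B) (hp : Primrec p)
    (hq : Primrec q) : PrimrecPred fun a => LdRule (T a) (A a) (B a) (p a) (q a) := by
  have hq' := primrec_add_const hq 1
  have hp0 : PrimrecPred fun a => p a = 0 := Primrec.eq.comp hp (const 0)
  have hsucc : PrimrecPred fun a => q a < T a → q a + 1 < T a ∧ A a (q a + 1) ≤ T a :=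
    primrecPred_imp (nat_lt.comp hq hT)
      ((nat_lt.comp hq' hT).and (nat_le.comp (hA.comp .id hq') hT))
  exact (hp0.and (Primrec.eq.comp hq (const 0))).or <| hp0.not.and <|
    (nat_le.comp (hB.comp .id hp) hT).and <| (nat_le.comp (hA.comp .id hq) hT).and <|
    hsucc.and (primrecPred_ldSpec hT hA hB hp hq)

theorem primrecPred_rdRule (hT : Primrec T) (hA : Primrec₂ A) (hB : Primrec₂ B) (hp : Primrec p)
    (hq : Primrec q) : PrimrecPred fun a => RdRule (T a) (A a) (B a) (p a) (q a) := by
  refine .or ?_ (.or ?_ (.or ?_ (primrecPred_exists_lt hT ?_)))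
  · exact (Primrec.eq.comp hp (const 0)).and (Primrec.eq.comp hq (const 0))
  · exact (nat_lt.comp (hB.comp .id hT) hp).and (Primrec.eq.comp hq hT)
  · exact (Primrec.eq.comp hp hT).and
      ((primrecPred_approaches hT hB).and (Primrec.eq.comp hq (hA.comp .id hT)))
  · have hT' := hT.comp (fst (α := α) (β := ℕ))
    have hp' := hp.comp (fst (α := α) (β := ℕ))
    have hk := primrec_add_const (snd (α := α) (β := ℕ)) 1
    have hBk := hB.comp fst hk
    exact (nat_lt.comp hk hT').and <| (nat_lt.comp hB hp').and <| (nat_le.comp hp' hBk).and <|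
      (nat_le.comp hBk hT').and (Primrec.eq.comp (hq.comp fst) (hA.comp fst hk))

variable {V : α → WarpTerm → ℕ → ℕ}

theorem primrec₂_row (hV : Primrec fun x : α × WarpTerm × ℕ => V x.1 x.2.1 x.2.2) {f : β → α}
    {t : β → WarpTerm} (hf : Primrec f) (ht : Primrec t) : Primrec₂ fun b p => V (f b) (t b) p :=
  hV.comp ((hf.comp fst).pair ((ht.comp fst).pair snd))

theorem primrecRel_valueRule (hT : Primrec T)
    (hV : Primrec fun x : α × WarpTerm × ℕ => V x.1 x.2.1 x.2.2) (hp : Primrec p)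
    (hq : Primrec q) : PrimrecRel fun a t => ValueRule (T a) (V a) (p a) (q a) t := by
  have hp0 : PrimrecPred fun a => p a = 0 := Primrec.eq.comp hp (const 0)
  have hq0 : PrimrecPred fun a => q a = 0 := Primrec.eq.comp hq (const 0)
  have hT' := hT.comp (fst (α := α) (β := WarpTerm × WarpTerm))
  have hp' := hp.comp (fst (α := α) (β := WarpTerm × WarpTerm))
  have hq' := hq.comp (fst (α := α) (β := WarpTerm × WarpTerm))
  have hs := primrec₂_row hV fst (fst.comp snd : Primrec fun x : α × WarpTerm × WarpTerm => x.2.1)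
  have ht := primrec₂_row hV fst (snd.comp snd : Primrec fun x : α × WarpTerm × WarpTerm => x.2.2)
  have hsp := hs.comp .id hp'
  have htp := ht.comp .id hp'
  refine WarpTerm.primrecRel_of_constructors ?_ (Primrec.eq.comp hq hp) hq0
    ((hp0.and hq0).or (hp0.not.and (Primrec.eq.comp hq hT))) ?_ ?_ ?_
    (primrecPred_ldRule hT' hs ht hp' hq') (primrecPred_rdRule hT' hs ht hp' hq')
  · exact primrecPred_varRule (hT.comp fst) (primrec₂_row hV fst (WarpTerm.primrec_var.comp snd))
      (hp.comp fst) (hq.comp fst)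
  · exact (nat_le.comp hsp hT').and <| (nat_le.comp htp hT').and <|
      Primrec.eq.comp hq' (nat_min.comp hsp htp)
  · exact (nat_le.comp hsp hT').and <| (nat_le.comp htp hT').and <|
      Primrec.eq.comp hq' (nat_max.comp hsp htp)
  · exact (nat_le.comp htp hT').and (Primrec.eq.comp hq' (hs.comp .id htp))

theorem primrecRel_reachRule (hT : Primrec T)
    (hV : Primrec fun x : α × WarpTerm × ℕ => V x.1 x.2.1 x.2.2) :
    PrimrecRel fun a t => ReachRule (T a) (V a) t := by
  have hT' := hT.comp (fst (α := α) (β := WarpTerm × WarpTerm))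
  have hs := primrec₂_row hV fst (fst.comp snd : Primrec fun x : α × WarpTerm × WarpTerm => x.2.1)
  have ht := primrec₂_row hV fst (snd.comp snd : Primrec fun x : α × WarpTerm × WarpTerm => x.2.2)
  have hsT := hs.comp .id hT'
  have htT := ht.comp .id hT'
  have hsR := primrecPred_reaches hT' hs
  have htR := primrecPred_reaches hT' ht
  have hlast {op : WarpTerm → WarpTerm → WarpTerm} {r : ℕ}
      (hop : ∀ s t, (op s t).code = 6 * Nat.pair s.code t.code + r) := Primrec.eq.comp
    ((primrec₂_row hV fst ((WarpTerm.primrec₂_of_code_eq r hop).comp (fst.comp snd)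
      (snd.comp snd))).comp .id hT') hT'
  refine WarpTerm.primrecRel_of_constructors ?_ (primrecPred_const _) (primrecPred_const _)
    (primrecPred_const _) (hsR.and htR) (hsR.or htR) ?_ ?_ ?_
  · exact primrecPred_reaches (hT.comp fst) (primrec₂_row hV fst (WarpTerm.primrec_var.comp snd))
  · exact (hlast (op := .comp) fun _ _ => rfl).and (hsR.or htR)
  · exact (nat_le.comp hsT htT).and (primrecPred_imp (Primrec.eq.comp hsT hT') htR)
  · exact (hlast (op := .rd) fun _ _ => rfl).and
      (primrecPred_imp (primrecPred_approaches hT' ht) hsR)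

theorem primrecRel_rowRule (hT : Primrec T)
    (hV : Primrec fun x : α × WarpTerm × ℕ => V x.1 x.2.1 x.2.2) :
    PrimrecRel fun a t => RowRule (T a) (V a) t := by
  have hT' := hT.comp (fst (α := α) (β := WarpTerm))
  have hrow : Primrec₂ fun (x : α × WarpTerm) p => V x.1 x.2 p := primrec₂_row hV fst snd
  have hvalue : PrimrecRel fun (x : α × WarpTerm) p => V x.1 x.2 p ≤ T x.1 →
      ValueRule (T x.1) (V x.1) p (V x.1 x.2 p) x.2 :=
    primrecPred_imp (nat_le.comp hrow (hT'.comp fst)) <|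
      (primrecRel_valueRule (hT'.comp fst) (hV.comp ((fst.comp (fst.comp fst)).pair snd)) snd
        hrow).comp .id (snd.comp fst)
  exact (nat_le.comp (hrow.comp .id hT') hT').and <| (primrecPred_forall_le hT' hvalue).and <|
    primrecPred_iff (primrecPred_reaches hT' hrow) (primrecRel_reachRule hT hV)

theorem primrecPred_isCertificate {N : α → ℕ} (hN : Primrec N) (hT : Primrec T)
    (hV : Primrec fun x : α × WarpTerm × ℕ => V x.1 x.2.1 x.2.2) :
    PrimrecPred fun a => IsCertificate (N a) (T a) (V a) := by
  have hrows : PrimrecPred fun a => ∀ n ≤ N a, RowRule (T a) (V a) (.ofCode n) :=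
    primrecPred_forall_le hN
      ((primrecRel_rowRule hT hV).comp fst (WarpTerm.primrec_ofCode.comp snd))
  refine ((nat_lt.comp (const 0) hT).and hrows).of_eq fun a => and_congr_right fun _ => ?_
  exact ⟨fun h t ht => t.ofCode_code ▸ h t.code ht,
    fun h n hn => h _ ((WarpTerm.code_ofCode n).trans_le hn)⟩

theorem primrec_decode {c : α → ℕ} {t : α → WarpTerm} (hT : Primrec T) (hc : Primrec c)
    (ht : Primrec t) (hp : Primrec p) : Primrec fun a => decode (T a) (c a) (t a) (p a) := by
  have hbase := primrec_add_const hT 2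
  exact nat_mod.comp (nat_div.comp hc (primrec₂_pow.comp hbase
    (Primrec₂.natPair.comp (WarpTerm.primrec_code.comp ht) hp))) hbase

theorem primrec_certificateBound : Primrec certificateBound :=
  nat_mul.comp (const 3) (primrec₂_pow.comp
    (primrec_add_const (nat_mul.comp (const 5) (primrec_add_const .id 1)) 1)
    (primrec_add_const .id 2))

theorem primrec_code_add_code : Primrec fun e : WarpTerm × WarpTerm => e.1.code + e.2.code :=
  nat_add.comp (WarpTerm.primrec_code.comp fst) (WarpTerm.primrec_code.comp snd)

theorem primrecPred_isRefutation :
    PrimrecPred fun x : ((WarpTerm × WarpTerm) × ℕ) × ℕ => IsRefutation x.1.1 x.1.2 x.2 := by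
  have he : Primrec fun x : ((WarpTerm × WarpTerm) × ℕ) × ℕ => x.1.1 := fst.comp fst
  have hT : Primrec fun x : ((WarpTerm × WarpTerm) × ℕ) × ℕ => x.1.2 := snd.comp fst
  have hcert : PrimrecPred fun x : ((WarpTerm × WarpTerm) × ℕ) × ℕ =>
      IsCertificate (x.1.1.1.code + x.1.1.2.code) x.1.2 (decode x.1.2 x.2) :=
    primrecPred_isCertificate (primrec_code_add_code.comp he) hT
      (primrec_decode (hT.comp fst) (snd.comp fst) (fst.comp snd) (snd.comp snd))
  have hs := primrec_decode (hT.comp fst) (snd.comp fst) (fst.comp (he.comp fst)) snd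
  have ht := primrec_decode (hT.comp fst) (snd.comp fst) (snd.comp (he.comp fst)) snd
  have hdiff := (nat_le.comp hs (hT.comp fst)).and <|
    (nat_le.comp ht (hT.comp fst)).and (Primrec.eq.comp hs ht).not
  exact hcert.and (primrecPred_exists_lt (primrec_add_const hT 1) hdiff)

theorem primrecPred_models : PrimrecPred Models := by
  have hN := primrec_code_add_code.comp (fst (α := WarpTerm × WarpTerm) (β := ℕ))
  have hc := primrec₂_pow.comp (primrec_add_const snd 2)
    (primrec₂_pow.comp (primrec_add_const (nat_add.comp hN snd) 1) (const 2))
  have hcode : PrimrecRel fun (e : WarpTerm × WarpTerm) T =>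
      ∃ c < (T + 2) ^ ((e.1.code + e.2.code + T + 1) ^ 2), IsRefutation e T c :=
    primrecPred_exists_lt hc primrecPred_isRefutation
  have hbound := primrec_certificateBound.comp primrec_code_add_code
  exact (primrecPred_exists_lt hbound hcode).not.of_eq fun _ => not_iff_comm.1 not_models_iff

end primrec

end TimeWarp

theorem theorem1 :
    ComputablePred fun e : WarpTerm × WarpTerm => e ∈ TimeWarp.equationalTheory := by
  obtain ⟨hd, h⟩ := TimeWarp.primrecPred_models
  exact ⟨hd, h.to_comp⟩
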